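/- Conventions. A CAT(0) space is a non-empty geodesic metric space in which every geodesic triangle satisfies the comparison inequality with its Euclidean comparison triangle. A flat in a CAT(0) space $X$ is the image of an isometric embedding of a Euclidean space $\mathbb{E}^k$ with $k\ge 2$; a maximal flat is a flat not properly contained in another flat. $X$ has isolated flats if there is a family $\mathcal F$ of flats in $X$ such that (i) there is $B\ge 0$ such that every flat in $X$ is contained in the $B$-neighbourhood of some member of $\mathcal F$, and (ii) there is a function $\phi:\mathbb R_{\ge 0}\to\mathbb R_{\ge 0}$ such that for all distinct $E_1,E_2\in\mathcal F$ and all $k\ge 0$ the intersection of the $k$-neighbourhoods of $E_1$ and $E_2$ has diameter less than $\phi(k)$. All actions are by isometries; an action of $\Gamma$ on $X$ is proper if every $x\in X$ has a ball $B(x,r)$, $r>0$, with $\{g\in\Gamma : gB(x,r)\cap B(x,r)\ne\emptyset\}$ finite, and cocompact if $X=\Gamma K$ for some compact $K\subseteq X$. A proper cocompact action of $\Gamma$ on a CAT(0) space $X$ with isolated flats is toral if for each maximal flat $E\subseteq X$ the stabiliser $\{g\in\Gamma : gE=E\}$ is free abelian. A CAT(0) group with isolated flats is a group admitting a proper cocompact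 action on a CAT(0) space with isolated flats; it is toral if it admits such an action that is toral. A subgroup $K\le G$ is malnormal if $gKg^{-1}\cap K=\{1\}$ for all $g\in G\smallsetminus K$, and $G$ is CSA if every maximal abelian subgroup of $G$ is malnormal. Lemma. Let $\Gamma$ be a torsion-free group. (1) If $\Gamma$ admits a proper, cocompact and toral action on a CAT(0) space with isolated flats, then every proper and cocompact action of $\Gamma$ on a CAT(0) space with isolated flats is toral. (2) If $\Gamma$ is a CAT(0) group with isolated flats, then $\Gamma$ is toral if and only if $\Gamma$ is CSA. -/

import Mathlib

open scoped Pointwise NNReal ENNReal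

universe u v w

/-- `S` is (the image of) a geodesic from `x` to `y`: the image of an isometric path
`c : [0, d(x,y)] → X` with `c 0 = x` and `c (d(x,y)) = y`. -/
def IsGeodesicSegment {X : Type v} [MetricSpace X] (x y : X) (S : Set X) : Prop :=
  ∃ c : ℝ → X, c 0 = x ∧ c (dist x y) = y ∧
    (∀ s ∈ Set.Icc 0 (dist x y), ∀ t ∈ Set.Icc 0 (dist x y), dist (c s) (c t) = |s - t|) ∧
    c '' Set.Icc 0 (dist x y) = S

/-- The Euclidean plane. -/
abbrev EPlane : Type := EuclideanSpace ℝ (Fin 2)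

/-- A (non-empty) CAT(0) space: a geodesic metric space all of whose geodesic triangles are at
least as thin as their Euclidean comparison triangles. The vertices `x, y, z` are arbitrary, so
it is enough to compare a point `p` of the side `[x, y]` with a point `q` of the side `[x, z]`
(two points of one and the same side are at the comparison distance in any case). -/
structure IsCAT0 (X : Type v) [MetricSpace X] : Prop where
  nonempty : Nonempty X
  geodesic : ∀ x y : X, ∃ S : Set X, IsGeodesicSegment x y S
  comparison : ∀ (x y z : X) (Sxy Sxz Syz : Set X),
    IsGeodesicSegment x y Sxy → IsGeodesicSegment x z Sxz → IsGeodesicSegment y z Syz →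
    ∀ x' y' z' : EPlane,
      dist x' y' = dist x y → dist x' z' = dist x z → dist y' z' = dist y z →
    ∀ p ∈ Sxy, ∀ q ∈ Sxz,
    ∀ p' ∈ segment ℝ x' y', ∀ q' ∈ segment ℝ x' z',
      dist x' p' = dist x p → dist x' q' = dist x q →
      dist p q ≤ dist p' q'

/-- A flat: an isometrically embedded copy of Euclidean space of some dimension `k ≥ 2`. -/
def IsFlat {X : Type v} [MetricSpace X] (E : Set X) : Prop :=
  ∃ k : ℕ, 2 ≤ k ∧ ∃ f : EuclideanSpace ℝ (Fin k) → X, Isometry f ∧ Set.range f = E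

/-- A maximal flat: a flat that is not properly contained in another flat. -/
def IsMaximalFlat {X : Type v} [MetricSpace X] (E : Set X) : Prop :=
  Maximal (IsFlat (X := X)) E

/-- The isolated flats condition. The diameter is the extended one, so that the bound says in
particular that the intersection of the neighbourhoods is a bounded set. -/
def HasIsolatedFlats (X : Type v) [MetricSpace X] : Prop :=
  ∃ F : Set (Set X), (∀ E ∈ F, IsFlat E) ∧
    (∃ B : ℝ≥0, ∀ E : Set X, IsFlat E → ∃ E' ∈ F, E ⊆ Metric.cthickening (B : ℝ) E') ∧
    (∃ φ : ℝ≥0 → ℝ≥0, ∀ E₁ ∈ F, ∀ E₂ ∈ F, E₁ ≠ E₂ → ∀ k : ℝ≥0,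
      Metric.ediam (Metric.cthickening (k : ℝ) E₁ ∩ Metric.cthickening (k : ℝ) E₂)
        < (φ k : ℝ≥0∞))

/-- A proper and cocompact action by isometries: every point has a ball that meets only finitely
many of its translates, and the translates of some compact set cover the space. -/
structure IsProperCocompactAction (Γ : Type u) [Group Γ] (X : Type v) [MetricSpace X]
    [MulAction Γ X] : Prop where
  isometry : ∀ g : Γ, Isometry (fun x : X => g • x)
  proper : ∀ x : X, ∃ r > 0,
    {g : Γ | ((g • Metric.ball x r) ∩ Metric.ball x r).Nonempty}.Finite
  cocompact : ∃ K : Set X, IsCompact K ∧ (⋃ g : Γ, g • K) = Set.univ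

/-- A free abelian group (of any rank), written multiplicatively. -/
def IsFreeAbelian (H : Type u) [Group H] : Prop :=
  ∃ ι : Type u, Nonempty (H ≃* Multiplicative (ι →₀ ℤ))

/-- The set-wise stabiliser of each maximal flat is free abelian. -/
def IsToralAction (Γ : Type u) [Group Γ] (X : Type v) [MetricSpace X] [MulAction Γ X] : Prop :=
  ∀ E : Set X, IsMaximalFlat E → IsFreeAbelian (MulAction.stabilizer Γ E)

/-- `Γ` admits a proper cocompact isometric action on a CAT(0) space with isolated flats. -/
def IsCAT0GroupWithIsolatedFlats (Γ : Type u) [Group Γ] : Prop :=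
  ∃ (X : Type v) (_ : MetricSpace X) (_ : MulAction Γ X),
    IsCAT0 X ∧ HasIsolatedFlats X ∧ IsProperCocompactAction Γ X

/-- `Γ` admits a proper cocompact isometric toral action on a CAT(0) space with isolated
flats. -/
def IsToralCAT0GroupWithIsolatedFlats (Γ : Type u) [Group Γ] : Prop :=
  ∃ (X : Type v) (_ : MetricSpace X) (_ : MulAction Γ X),
    IsCAT0 X ∧ HasIsolatedFlats X ∧ IsProperCocompactAction Γ X ∧ IsToralAction Γ X

/-- A malnormal subgroup. -/
def IsMalnormal {G : Type u} [Group G] (K : Subgroup G) : Prop :=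
  ∀ g : G, g ∉ K → K.map (MulAut.conj g).toMonoidHom ⊓ K = ⊥

/-- A CSA group: every maximal abelian subgroup is malnormal. -/
def IsCSA (G : Type u) [Group G] : Prop :=
  ∀ A : Subgroup G, Maximal (fun H : Subgroup G => IsMulCommutative H) A → IsMalnormal A

/-! CSA does not refer to any space. Both parts of the lemma therefore reduce to two implications
for a torsion-free group: a toral action gives CSA (`isCSA_of_isToralAction`), and CSA makes flat
stabilisers free abelian in every proper cocompact action (`isFreeAbelian_stabilizer_of_isCSA`).

From CSA to toral. The stabiliser of a flat acts on it as a discrete group of Euclidean isometries,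
freely because there is no torsion. By a Bieberbach argument, elements with linear part near 1
commute, and every element has a positive power of this kind. In a CSA group commutation is
transitive on non-trivial elements, so the whole stabiliser is abelian. An abelian discrete free
group of Euclidean isometries acts by translations on some orbit, hence is a lattice in a subspace.

From toral to CSA. Let A be maximal abelian and let g conjugate b to a, both non-trivial in A. It
suffices to find an abelian subgroup containing A and g. If a coarsely preserves a member E of the
isolated family, take the coarse stabiliser of E. Isolation makes it malnormal, and a circumcentre
argument gives it an invariant flat parallel to E. That flat is maximal, so torality makes the group
abelian. Otherwise take the coarse stabiliser of an axis of a. The lines parallel to the axis stay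
within a bounded distance of it, since a wide flat strip would force the axis to lie near a member
of the family. Hence the group preserves a line parallel to the axis, acts on it freely by
translations, and is abelian. -/

/-! ### Discrete groups of Euclidean isometries -/

/-- In a normed algebra, an element all of whose powers are close to `1` equals `1`. -/
theorem eq_one_of_norm_pow_sub_one_le {R : Type*} [NormedRing R] [NormedAlgebra ℝ R] (x : R)
    (h : ∀ n : ℕ, ‖x ^ n - 1‖ ≤ 1 / 2) : x = 1 := by
  -- Since y² - 1 = 2(y - 1) + (y - 1)², squaring expands the distance to 1 by a factor 3/2 while
  -- that distance is at most 1/2. Repeated squaring of x ≠ 1 would leave the ball.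
  have step : ∀ y : R, ‖y - 1‖ ≤ 1 / 2 → (3 / 2) * ‖y - 1‖ ≤ ‖y ^ 2 - 1‖ := by
    intro y hy
    have e : (2 : ℝ) • (y - 1) = (y ^ 2 - 1) - (y - 1) * (y - 1) := by
      rw [two_smul]; noncomm_ring
    have h2 : ‖(2 : ℝ) • (y - 1)‖ ≤ ‖y ^ 2 - 1‖ + ‖y - 1‖ * ‖y - 1‖ := by
      rw [e]
      exact (norm_sub_le _ _).trans (by gcongr; exact norm_mul_le _ _)
    rw [norm_smul, Real.norm_ofNat] at h2
    nlinarith [norm_nonneg (y - 1)]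
  have key : ∀ n : ℕ, (3 / 2 : ℝ) ^ n * ‖x - 1‖ ≤ ‖x ^ (2 ^ n) - 1‖ := by
    intro n
    induction n with
    | zero => simp
    | succ n ih =>
      have := step (x ^ (2 ^ n)) (h _)
      rw [← pow_mul, ← pow_succ] at this
      rw [pow_succ]
      linarith
  by_contra hx
  have hpos : 0 < ‖x - 1‖ := norm_pos_iff.2 (sub_ne_zero.2 hx)
  obtain ⟨n, hn⟩ := pow_unbounded_of_one_lt (1 / ‖x - 1‖) (by norm_num : (1 : ℝ) < 3 / 2)
  rw [div_lt_iff₀ hpos] at hn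
  have := key n
  have := h (2 ^ n)
  linarith

/-- An action of a group on a normed space by affine isometries, given by its linear and
translation parts. -/
structure AffineIsometricAction (H : Type*) [Group H] (V : Type*) [NormedAddCommGroup V]
    [NormedSpace ℝ V] where
  /-- the linear part -/
  lin : H →* (V →L[ℝ] V)
  /-- the translation part -/
  trans : H → V
  norm_lin : ∀ h v, ‖lin h v‖ = ‖v‖
  trans_mul : ∀ g h, trans (g * h) = lin g (trans h) + trans g

open scoped commutatorElement

namespace AffineIsometricAction

/-! ### Norm estimates for commutators of affine isometries. -/

section Normed

variable {H : Type*} [Group H] {V : Type*} [NormedAddCommGroup V] [NormedSpace ℝ V]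
  (ρ : AffineIsometricAction H V)

theorem trans_one : ρ.trans 1 = 0 := by
  have := ρ.trans_mul 1 1
  simpa using this

theorem opNorm_lin_le (h : H) : ‖ρ.lin h‖ ≤ 1 :=
  ContinuousLinearMap.opNorm_le_bound _ zero_le_one fun v => by rw [ρ.norm_lin, one_mul]

theorem norm_lin_mul_le (h : H) (x : V →L[ℝ] V) : ‖ρ.lin h * x‖ ≤ ‖x‖ :=
  (norm_mul_le _ _).trans (mul_le_of_le_one_left (norm_nonneg _) (ρ.opNorm_lin_le h))

theorem norm_mul_lin_le (h : H) (x : V →L[ℝ] V) : ‖x * ρ.lin h‖ ≤ ‖x‖ :=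
  (norm_mul_le _ _).trans (mul_le_of_le_one_right (norm_nonneg _) (ρ.opNorm_lin_le h))

theorem lin_mul_lin_inv (h : H) : ρ.lin h * ρ.lin h⁻¹ = 1 := by
  rw [← map_mul, mul_inv_cancel, map_one]

theorem lin_inv_mul_lin (h : H) : ρ.lin h⁻¹ * ρ.lin h = 1 := by
  rw [← map_mul, inv_mul_cancel, map_one]

theorem lin_commutator_mul (h c : H) :
    ρ.lin ⁅h, c⁆ * ρ.lin c = ρ.lin h * ρ.lin c * ρ.lin h⁻¹ := by
  simp only [← map_mul, commutatorElement_def]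
  congr 1; group

/-- If `lin h` commutes with its commutator with `lin c`, and `lin c` is close to `1`, then
`lin h` commutes with `lin c`. -/
theorem lin_commutator_eq_one (h c : H) (hc : ‖ρ.lin c - 1‖ ≤ 1 / 4)
    (hcomm : ρ.lin h * ρ.lin ⁅h, c⁆ = ρ.lin ⁅h, c⁆ * ρ.lin h) : ρ.lin ⁅h, c⁆ = 1 := by
  set d := ⁅h, c⁆ with hd
  have conj_pow : ∀ n : ℕ,
      ρ.lin (h ^ n) * ρ.lin c * ρ.lin (h ^ n)⁻¹ = ρ.lin d ^ n * ρ.lin c := by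
    intro n
    induction n with
    | zero => simp
    | succ n ih =>
      have e : ρ.lin (h ^ (n + 1)) * ρ.lin c * ρ.lin (h ^ (n + 1))⁻¹ =
          ρ.lin h * (ρ.lin (h ^ n) * ρ.lin c * ρ.lin (h ^ n)⁻¹) * ρ.lin h⁻¹ := by
        simp only [← map_mul]
        congr 1
        rw [pow_succ']; group
      have hcomm' : ρ.lin h * ρ.lin d ^ n = ρ.lin d ^ n * ρ.lin h :=
        ((show Commute (ρ.lin h) (ρ.lin d) from hcomm).pow_right n).eq
      rw [e, ih, ← mul_assoc, hcomm', mul_assoc, mul_assoc, ← mul_assoc (ρ.lin h),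
        ← ρ.lin_commutator_mul h c, ← mul_assoc, ← pow_succ]
  -- By `conj_pow`, the n-th power of `lin d` is a conjugate of `lin c` times the inverse of `lin
  -- c`; both are within 1/4 of 1.
  refine eq_one_of_norm_pow_sub_one_le _ fun n => ?_
  have e1 : ρ.lin d ^ n - 1 =
      ρ.lin (h ^ n) * (ρ.lin c - 1) * ρ.lin (h ^ n)⁻¹ * ρ.lin c⁻¹ +
        ρ.lin c⁻¹ * (1 - ρ.lin c) := by
    rw [mul_sub, sub_mul, sub_mul, conj_pow, mul_assoc (_ ^ n), mul_one, lin_mul_lin_inv, mul_one,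
      lin_mul_lin_inv, one_mul, mul_sub, lin_inv_mul_lin, mul_one]
    abel
  rw [e1]
  have h1 : ‖ρ.lin (h ^ n) * (ρ.lin c - 1) * ρ.lin (h ^ n)⁻¹ * ρ.lin c⁻¹‖ ≤ 1 / 4 :=
    ((ρ.norm_mul_lin_le _ _).trans ((ρ.norm_mul_lin_le _ _).trans (ρ.norm_lin_mul_le _ _))).trans hc
  have h2 : ‖ρ.lin c⁻¹ * (1 - ρ.lin c)‖ ≤ 1 / 4 := by
    refine (ρ.norm_lin_mul_le _ _).trans ?_
    rwa [norm_sub_rev]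
  refine (norm_add_le _ _).trans ?_
  linarith

/-- The bound is quadratic because AC - CA = (A - 1)(C - 1) - (C - 1)(A - 1). -/
theorem norm_lin_commutator_sub_one_le (h c : H) :
    ‖ρ.lin ⁅h, c⁆ - 1‖ ≤ 2 * ‖ρ.lin h - 1‖ * ‖ρ.lin c - 1‖ := by
  have e : ρ.lin ⁅h, c⁆ - 1 = ((ρ.lin h - 1) * (ρ.lin c - 1) - (ρ.lin c - 1) * (ρ.lin h - 1)) *
      ρ.lin (h⁻¹ * c⁻¹) := by
    have e1 : (ρ.lin h - 1) * (ρ.lin c - 1) - (ρ.lin c - 1) * (ρ.lin h - 1) =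
      ρ.lin h * ρ.lin c - ρ.lin c * ρ.lin h := by noncomm_ring
    rw [e1, sub_mul, ← map_mul, ← map_mul, ← map_mul, ← map_mul, commutatorElement_def,
      ← map_one ρ.lin]
    congr 2 <;> group
  rw [e]
  refine (ρ.norm_mul_lin_le _ _).trans ((norm_sub_le _ _).trans ?_)
  have h1 := norm_mul_le (ρ.lin h - 1) (ρ.lin c - 1)
  have h2 := norm_mul_le (ρ.lin c - 1) (ρ.lin h - 1)
  linarith

theorem trans_commutator (h c : H) :
    ρ.trans ⁅h, c⁆ = ρ.lin h (ρ.trans c) + ρ.trans h -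
      ρ.lin ⁅h, c⁆ (ρ.lin c (ρ.trans h) + ρ.trans c) := by
  have e : ⁅h, c⁆ * (c * h) = h * c := by rw [commutatorElement_def]; group
  have := ρ.trans_mul ⁅h, c⁆ (c * h)
  rw [e, ρ.trans_mul, ρ.trans_mul] at this
  rw [this]; abel

theorem norm_trans_commutator_le (h c : H) :
    ‖ρ.trans ⁅h, c⁆‖ ≤ (‖ρ.lin h - 1‖ + ‖ρ.lin ⁅h, c⁆ - 1‖) * ‖ρ.trans c‖ +
      ‖ρ.lin c - 1‖ * ‖ρ.trans h‖ := by
  have e : ρ.trans ⁅h, c⁆ = (ρ.lin h - 1) (ρ.trans c) - (ρ.lin ⁅h, c⁆ - 1) (ρ.trans c) -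
      (ρ.lin h * (ρ.lin c - 1) * ρ.lin h⁻¹) (ρ.trans h) := by
    have e1 : ρ.lin h * (ρ.lin c - 1) * ρ.lin h⁻¹ = ρ.lin ⁅h, c⁆ * ρ.lin c - 1 := by
      rw [lin_commutator_mul, mul_sub, sub_mul, mul_one, lin_mul_lin_inv]
    rw [e1, trans_commutator]
    simp only [map_add, sub_apply, one_apply_eq_self,
      mul_apply_eq_comp]
    abel
  rw [e]
  have h1 := (ρ.lin h - 1).le_opNorm (ρ.trans c)
  have h2 := (ρ.lin ⁅h, c⁆ - 1).le_opNorm (ρ.trans c)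
  have h3 := (ρ.lin h * (ρ.lin c - 1) * ρ.lin h⁻¹).le_opNorm (ρ.trans h)
  have h4 : ‖ρ.lin h * (ρ.lin c - 1) * ρ.lin h⁻¹‖ ≤ ‖ρ.lin c - 1‖ :=
    (ρ.norm_mul_lin_le _ _).trans (ρ.norm_lin_mul_le _ _)
  have h5 := mul_le_mul_of_nonneg_right h4 (norm_nonneg (ρ.trans h))
  refine (norm_sub_le _ _).trans ?_
  have h6 := norm_sub_le ((ρ.lin h - 1) (ρ.trans c)) ((ρ.lin ⁅h, c⁆ - 1) (ρ.trans c))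
  linarith

/-- The iterated commutators `⁅h, ⁅h, … ⁅h, g⁆⁆⁆` of two elements with small linear parts
contract to the identity. -/
theorem iterate_commutator_bounds {g h : H} (hg : ‖ρ.lin g - 1‖ ≤ 1 / 4)
    (hh : ‖ρ.lin h - 1‖ ≤ 1 / 4) (n : ℕ) :
    ‖ρ.lin ((fun c => ⁅h, c⁆)^[n] g) - 1‖ ≤ (1 / 2) ^ n * (1 / 4) ∧
    ‖ρ.trans ((fun c => ⁅h, c⁆)^[n] g)‖ ≤
      (1 / 2) ^ n * (‖ρ.trans g‖ + 2 * ‖ρ.trans h‖) := by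
  induction n with
  | zero =>
    refine ⟨by simpa using hg, ?_⟩
    simp
  | succ n ih =>
    obtain ⟨ih1, ih2⟩ := ih
    rw [Function.iterate_succ_apply']
    set c := (fun c => ⁅h, c⁆)^[n] g
    have a1 := ρ.norm_lin_commutator_sub_one_le h c
    have a2 := ρ.norm_trans_commutator_le h c
    have p1 : (1 / 2 : ℝ) ^ n ≤ 1 := pow_le_one₀ (by norm_num) (by norm_num)
    have p0 : (0 : ℝ) < (1 / 2) ^ n := by positivity
    have b1 : ‖ρ.lin ⁅h, c⁆ - 1‖ ≤ (1 / 2) ^ (n + 1) * (1 / 4) := by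
      rw [pow_succ]
      nlinarith [norm_nonneg (ρ.lin c - 1)]
    refine ⟨b1, ?_⟩
    have b2 : ‖ρ.lin ⁅h, c⁆ - 1‖ ≤ 1 / 8 := by
      rw [pow_succ] at b1; linarith
    -- The recursion is t ↦ (3/8)t + (1/4)(1/2)^n ‖trans h‖. The coefficient 2 in the claimed bound
    -- is chosen so that (3/8)·2 + 1/4 = (1/2)·2.
    have b3 : (‖ρ.lin h - 1‖ + ‖ρ.lin ⁅h, c⁆ - 1‖) * ‖ρ.trans c‖ ≤ (3 / 8) * ‖ρ.trans c‖ :=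
      mul_le_mul_of_nonneg_right (by linarith) (norm_nonneg _)
    have b4 := mul_le_mul_of_nonneg_right ih1 (norm_nonneg (ρ.trans h))
    have b5 := mul_nonneg p0.le (norm_nonneg (ρ.trans g))
    rw [pow_succ]
    nlinarith

end Normed

/-! ### Discreteness: elements with small linear part commute. -/

section Inner

variable {H : Type*} [Group H] {V : Type*} [NormedAddCommGroup V] [InnerProductSpace ℝ V]
  (ρ : AffineIsometricAction H V)

open scoped InnerProductSpace

theorem inner_lin (h : H) (v w : V) : ⟪ρ.lin h v, ρ.lin h w⟫_ℝ = ⟪v, w⟫_ℝ := by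
  have := (LinearIsometry.mk (ρ.lin h : V →ₗ[ℝ] V) (ρ.norm_lin h)).inner_map_map v w
  simpa using this

theorem inner_lin_sub_eq_zero {h : H} {t : V} (ht : ρ.lin h t = t) (a : V) :
    ⟪t, ρ.lin h a - a⟫_ℝ = 0 := by
  have := ρ.inner_lin h t a
  rw [ht] at this
  rw [inner_sub_right, this, sub_self]

/-- For an orthogonal map the kernel and the range of `lin h - 1` are orthogonal, so there is no
nilpotent part. -/
theorem lin_fix_of_pow_apply_eq_zero (h : H) (n : ℕ) (t : V)
    (ht : ((ρ.lin h - 1) ^ n) t = 0) : ρ.lin h t = t := by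
  induction n generalizing t with
  | zero =>
    have : t = 0 := by simpa using ht
    simp [this]
  | succ n ih =>
    rw [pow_succ, mul_apply_eq_comp] at ht
    have h1 := ih _ ht
    have h2 := ρ.inner_lin_sub_eq_zero h1 t
    have h3 : (ρ.lin h - 1) t = ρ.lin h t - t := rfl
    rw [h3, inner_self_eq_zero] at h2
    exact sub_eq_zero.1 h2

/-- Discreteness at the point `v`, for a free action. -/
def IsDiscreteFreeAt (v : V) : Prop :=
  ∃ δ > 0, ∀ h : H, ‖ρ.lin h v + ρ.trans h - v‖ < δ → h = 1

variable {ρ}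

/-- The iterated commutators shrink, so by discreteness one of them is 1. Descending with
`lin_commutator_eq_one`, already the first has trivial linear part. From there on, commutation with
h applies `lin h - 1` to the translation part, and some power of `lin h - 1` kills it. -/
theorem commutator_parts (hρ : ρ.IsDiscreteFreeAt 0) {g h : H} (hg : ‖ρ.lin g - 1‖ ≤ 1 / 4)
    (hh : ‖ρ.lin h - 1‖ ≤ 1 / 4) :
    ρ.lin ⁅h, g⁆ = 1 ∧ ρ.lin h (ρ.trans ⁅h, g⁆) = ρ.trans ⁅h, g⁆ := by
  obtain ⟨δ, hδ, hfree⟩ := hρ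
  set c : ℕ → H := fun n => (fun c => ⁅h, c⁆)^[n] g with hc
  have hsucc : ∀ n, c (n + 1) = ⁅h, c n⁆ := fun n => Function.iterate_succ_apply' _ _ _
  obtain ⟨N, hN⟩ : ∃ N, c N = 1 := by
    set M := ‖ρ.trans g‖ + 2 * ‖ρ.trans h‖ with hM
    have hM0 : 0 ≤ M := by positivity
    obtain ⟨N, hN⟩ := exists_pow_lt_of_lt_one (div_pos hδ (by linarith : 0 < M + 1))
      (by norm_num : (1 / 2 : ℝ) < 1)
    refine ⟨N, hfree _ ?_⟩
    have h1 := (ρ.iterate_commutator_bounds hg hh N).2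
    rw [lt_div_iff₀ (by linarith)] at hN
    have p0 : (0 : ℝ) < (1 / 2) ^ N := by positivity
    simp only [map_zero, zero_add, sub_zero]
    change ‖ρ.trans (c N)‖ ≤ _ at h1
    nlinarith
  have small : ∀ n, ‖ρ.lin (c n) - 1‖ ≤ 1 / 4 := fun n => by
    have h1 := (ρ.iterate_commutator_bounds hg hh n).1
    have p1 : (1 / 2 : ℝ) ^ n ≤ 1 := pow_le_one₀ (by norm_num) (by norm_num)
    change ‖ρ.lin (c n) - 1‖ ≤ _ at h1
    linarith
  have down : ∀ n, ρ.lin (c (n + 1)) = 1 → ρ.lin (c 1) = 1 := by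
    intro n
    induction n with
    | zero => exact id
    | succ n ih =>
      intro h2
      refine ih ?_
      rw [hsucc n]
      refine ρ.lin_commutator_eq_one h (c n) (small n) ?_
      rw [← hsucc n]
      have e : ρ.lin (c (n + 1 + 1)) * (ρ.lin (c (n + 1)) * ρ.lin h) =
          ρ.lin h * ρ.lin (c (n + 1)) := by
        rw [hsucc (n + 1), ← mul_assoc, lin_commutator_mul, mul_assoc, lin_inv_mul_lin, mul_one]
      rw [h2, one_mul] at e
      exact e.symm
  have lin1 : ρ.lin (c 1) = 1 := by
    apply down N
    rw [hsucc, hN]; simp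
  have linn : ∀ n, ρ.lin (c (n + 1)) = 1 := by
    intro n
    induction n with
    | zero => exact lin1
    | succ n ih =>
      rw [hsucc]
      have := ρ.lin_commutator_mul h (c (n + 1))
      rw [ih, mul_one, mul_one, lin_mul_lin_inv] at this
      exact this
  have transn : ∀ n, ρ.trans (c (n + 1)) = ((ρ.lin h - 1) ^ n) (ρ.trans (c 1)) := by
    intro n
    induction n with
    | zero => simp
    | succ n ih =>
      have := linn (n + 1)
      rw [hsucc] at this ⊢
      rw [trans_commutator, this, linn n, pow_succ', mul_apply_eq_comp, ← ih]
      simp only [sub_apply, one_apply_eq_self]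
      abel
  refine ⟨lin1, ?_⟩
  refine ρ.lin_fix_of_pow_apply_eq_zero h N _ ?_
  have := transn N
  rw [hsucc, hN] at this
  rw [show ⁅h, g⁆ = c 1 from rfl, ← this]
  simp [ρ.trans_one]

/-- In a discrete group of Euclidean isometries acting freely, two elements with small linear
parts commute. -/
theorem commute_of_small (hρ : ρ.IsDiscreteFreeAt 0) {g h : H} (hg : ‖ρ.lin g - 1‖ ≤ 1 / 4)
    (hh : ‖ρ.lin h - 1‖ ≤ 1 / 4) : Commute g h := by
  obtain ⟨l1, f1⟩ := commutator_parts hρ hg hh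
  obtain ⟨l2, f2⟩ := commutator_parts hρ hh hg
  have hinv : ρ.trans ⁅g, h⁆ = - ρ.trans ⁅h, g⁆ := by
    have := ρ.trans_mul ⁅g, h⁆ ⁅h, g⁆
    rw [← commutatorElement_inv g h, mul_inv_cancel, trans_one, l2] at this
    rw [← commutatorElement_inv g h]
    exact eq_neg_of_add_eq_zero_right (by simpa using this.symm)
  rw [hinv, map_neg, neg_inj] at f2
  have ht := ρ.trans_commutator h g
  rw [l1] at ht
  -- The translation part is fixed by `lin h` and `lin g`, yet it is a difference of vectors in the
  -- ranges of `lin h - 1` and `lin g - 1`. It is thus orthogonal to itself.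
  have hzero : ρ.trans ⁅h, g⁆ = 0 := by
    have e : ρ.trans ⁅h, g⁆ = (ρ.lin h (ρ.trans g) - ρ.trans g) -
        (ρ.lin g (ρ.trans h) - ρ.trans h) := by
      rw [ht]; simp only [one_apply_eq_self]; abel
    have z : ⟪ρ.trans ⁅h, g⁆, (ρ.lin h (ρ.trans g) - ρ.trans g) -
        (ρ.lin g (ρ.trans h) - ρ.trans h)⟫_ℝ = 0 := by
      rw [inner_sub_right, ρ.inner_lin_sub_eq_zero f1, ρ.inner_lin_sub_eq_zero f2, sub_zero]
    rwa [← e, inner_self_eq_zero] at z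
  obtain ⟨δ, hδ, hfree⟩ := hρ
  have := hfree ⁅h, g⁆ (by simpa [hzero] using hδ)
  exact (commutatorElement_eq_one_iff_commute.1 this).symm

/-- The powers of `lin g` lie in a compact ball, so two of them are within 1/4; dividing by the
smaller power does not increase the norm. -/
theorem exists_pow_small [FiniteDimensional ℝ V] (g : H) :
    ∃ n : ℕ, 0 < n ∧ ‖ρ.lin (g ^ n) - 1‖ ≤ 1 / 4 := by
  have hb : ∀ n : ℕ, ρ.lin (g ^ n) ∈ Metric.closedBall (0 : V →L[ℝ] V) 1 := fun n => by
    simpa using ρ.opNorm_lin_le (g ^ n)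
  obtain ⟨a, -, φ, hφ, hlim⟩ := (isCompact_closedBall (0 : V →L[ℝ] V) 1).tendsto_subseq hb
  have hC := hlim.cauchySeq
  obtain ⟨N, hN⟩ := Metric.cauchySeq_iff'.1 hC (1 / 4) (by norm_num)
  have h1 := hN (N + 1) (Nat.le_succ N)
  have hlt : φ N < φ (N + 1) := hφ (Nat.lt_succ_self N)
  refine ⟨φ (N + 1) - φ N, by omega, ?_⟩
  have e : ρ.lin (g ^ (φ (N + 1) - φ N)) - 1 =
      ρ.lin (g ^ φ N)⁻¹ * (ρ.lin (g ^ φ (N + 1)) - ρ.lin (g ^ φ N)) := by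
    rw [mul_sub, lin_inv_mul_lin, ← map_mul]
    congr 2
    rw [pow_sub _ hlt.le]
    exact ((Commute.refl g).pow_pow _ _).inv_right.eq
  rw [e]
  refine (ρ.norm_lin_mul_le _ _).trans ?_
  rw [dist_eq_norm] at h1
  exact h1.le

end Inner

end AffineIsometricAction

namespace AffineIsometricAction

/-! ### Abelian groups of Euclidean isometries and lattices. -/

section Abelian

variable {H : Type*} [Group H] {V : Type*} [NormedAddCommGroup V] [InnerProductSpace ℝ V]
  {ρ : AffineIsometricAction H V}

/-- The displacement vector of `p` under `h`. -/
def displacement (ρ : AffineIsometricAction H V) (p : V) (h : H) : V :=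
  ρ.lin h p + ρ.trans h - p

theorem displacement_sub (p y : V) (h : H) :
    ρ.displacement (p - y) h = ρ.displacement p h - (ρ.lin h y - y) := by
  simp only [displacement, map_sub]; abel

theorem lin_displacement_sub {g h : H} (hcomm : g * h = h * g) (p : V) :
    ρ.lin h (ρ.displacement p g) - ρ.displacement p g =
      ρ.lin g (ρ.displacement p h) - ρ.displacement p h := by
  have h1 := ρ.trans_mul g h
  have h2 := ρ.trans_mul h g
  rw [hcomm, h2] at h1
  have h3 : ρ.lin g (ρ.lin h p) = ρ.lin h (ρ.lin g p) := by
    rw [← mul_apply_eq_comp, ← mul_apply_eq_comp, ← map_mul, ← map_mul, hcomm]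
  simp only [displacement, map_sub, map_add, h3]
  have h4 : ρ.lin h (ρ.trans g) = ρ.lin g (ρ.trans h) + ρ.trans g - ρ.trans h := by
    rw [← h1]; abel
  rw [h4]; abel

variable [FiniteDimensional ℝ V]

/-- On W, kernel and range of `lin h - 1` are orthogonal, hence complementary by rank-nullity. -/
theorem exists_fix_add_sub (h : H) (W : Submodule ℝ V) (hW : ∀ w ∈ W, ρ.lin h w ∈ W) {x : V}
    (hx : x ∈ W) : ∃ k ∈ W, ∃ y ∈ W, ρ.lin h k = k ∧ x = k + (ρ.lin h y - y) := by
  let T : W →ₗ[ℝ] W := ((ρ.lin h : V →ₗ[ℝ] V) - LinearMap.id).restrict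
    (p := W) (q := W) fun w hw => W.sub_mem (hW w hw) hw
  have hT : ∀ w : W, ((T w : W) : V) = ρ.lin h w - w := fun w => rfl
  have hdis : Disjoint (LinearMap.range T) (LinearMap.ker T) := by
    rw [Submodule.disjoint_def]
    rintro _ ⟨y, rfl⟩ hk
    have hk' : ρ.lin h (T y : V) = (T y : V) := by
      have := congrArg (Subtype.val) (LinearMap.mem_ker.1 hk)
      rw [hT] at this
      exact sub_eq_zero.1 this
    have := ρ.inner_lin_sub_eq_zero hk' (y : V)
    rw [← hT, inner_self_eq_zero] at this
    exact Subtype.ext this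
  have htop := Submodule.eq_top_of_disjoint _ _ (LinearMap.finrank_range_add_finrank_ker T).ge hdis
  obtain ⟨_, ⟨y, rfl⟩, k, hk, hxe⟩ := Submodule.mem_sup.1 (htop ▸ Submodule.mem_top :
    (⟨x, hx⟩ : W) ∈ LinearMap.range T ⊔ LinearMap.ker T)
  refine ⟨k, k.2, y, y.2, ?_, ?_⟩
  · have := congrArg (Subtype.val) (LinearMap.mem_ker.1 hk)
    rw [hT] at this
    exact sub_eq_zero.1 this
  · have := congrArg (Subtype.val) hxe
    rw [← hT, add_comm]
    exact this.symm

/-- Induction on the dimension of an invariant subspace W containing all displacements of p. If some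
h moves a vector of W, shifting p removes the part of the displacement of h in the range of `lin h -
1`; commutation then puts every displacement into the smaller subspace of vectors of W fixed by `lin
h`. -/
theorem exists_translation_point_aux (hcomm : ∀ g h : H, g * h = h * g) (n : ℕ) :
    ∀ (p : V) (W : Submodule ℝ V), Module.finrank ℝ W = n → (∀ h, ρ.displacement p h ∈ W) →
      (∀ h, ∀ w ∈ W, ρ.lin h w ∈ W) →
      ∃ q, ∀ g h, ρ.lin g (ρ.displacement q h) = ρ.displacement q h := by
  induction n using Nat.strong_induction_on with
  | _ n ih =>
    intro p W hn hp hW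
    by_cases hfix : ∀ h, ∀ w ∈ W, ρ.lin h w = w
    · exact ⟨p, fun g h => hfix g _ (hp h)⟩
    push Not at hfix
    obtain ⟨h, w, hw, hne⟩ := hfix
    obtain ⟨k, hk, y, hy, hkfix, hky⟩ := exists_fix_add_sub h W (hW h) (hp h)
    have hcommlin : ∀ g v, ρ.lin h (ρ.lin g v) = ρ.lin g (ρ.lin h v) := fun g v => by
      rw [← mul_apply_eq_comp, ← mul_apply_eq_comp, ← map_mul, ← map_mul, hcomm]
    let W' : Submodule ℝ V := W ⊓ LinearMap.ker ((ρ.lin h : V →ₗ[ℝ] V) - LinearMap.id)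
    have hW' : ∀ v, v ∈ W' ↔ v ∈ W ∧ ρ.lin h v = v := fun v => by
      simp only [W', Submodule.mem_inf, LinearMap.mem_ker, LinearMap.sub_apply, sub_eq_zero]
      rfl
    have hlt : W' < W := by
      refine lt_of_le_of_ne inf_le_left fun he => hne ?_
      exact ((hW' w).1 (he ▸ hw)).2
    have hpk : ρ.displacement (p - y) h = k := by
      rw [displacement_sub, hky]; abel
    refine ih _ (hn ▸ Submodule.finrank_lt_finrank_of_lt hlt) (p - y) W' rfl ?_ ?_
    · intro g
      rw [hW']
      constructor
      · rw [displacement_sub]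
        exact W.sub_mem (hp g) (W.sub_mem (hW g y hy) hy)
      -- Both sides of `e` are the same vector: the left one is in the range of `lin h - 1`, the
      -- right one is fixed by `lin h`, so it vanishes.
      · have e := lin_displacement_sub (ρ := ρ) (hcomm g h) (p - y)
        rw [hpk] at e
        have hf : ρ.lin h (ρ.lin g k - k) = ρ.lin g k - k := by
          rw [map_sub, hcommlin, hkfix]
        have := ρ.inner_lin_sub_eq_zero hf (ρ.displacement (p - y) g)
        rw [e, inner_self_eq_zero] at this
        rw [this] at e
        exact sub_eq_zero.1 e
    · intro g v hv
      rw [hW'] at hv ⊢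
      exact ⟨hW g v hv.1, by rw [hcommlin, hv.2]⟩

/-- An abelian group of Euclidean isometries acts by translations on some orbit. -/
theorem exists_translation_point (hcomm : ∀ g h : H, g * h = h * g) :
    ∃ q, ∀ g h, ρ.lin g (ρ.displacement q h) = ρ.displacement q h :=
  exists_translation_point_aux hcomm _ 0 ⊤ rfl (fun _ => Submodule.mem_top)
    fun _ _ _ => Submodule.mem_top

end Abelian

/-- Displacement at a translation point is an injective homomorphism into V with discrete image, and
discrete subgroups of V are free. -/
theorem isFreeAbelian_of_commute {H : Type u} [Group H] {V : Type*} [NormedAddCommGroup V]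
    [InnerProductSpace ℝ V] [FiniteDimensional ℝ V] {ρ : AffineIsometricAction H V}
    (hρ : ∀ v, ρ.IsDiscreteFreeAt v) (hcomm : ∀ g h : H, g * h = h * g) : IsFreeAbelian H := by
  obtain ⟨q, hq⟩ := exists_translation_point (ρ := ρ) hcomm
  let _ : CommGroup H := { ‹Group H› with mul_comm := hcomm }
  have hmul : ∀ g h, ρ.displacement q (g * h) = ρ.displacement q g + ρ.displacement q h := by
    intro g h
    have e : ρ.displacement q (g * h) = ρ.lin g (ρ.displacement q h) + ρ.displacement q g := by
      simp only [displacement, map_mul, ρ.trans_mul, mul_apply_eq_comp, map_sub, map_add]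
      abel
    rw [e, hq, add_comm]
  let φ : Additive H →+ V := AddMonoidHom.mk' (fun h => ρ.displacement q h.toMul)
    fun a b => hmul _ _
  obtain ⟨δ, hδ, hfree⟩ := hρ q
  have hinj : Function.Injective φ := by
    rw [injective_iff_map_eq_zero]
    intro a ha
    have : a.toMul = 1 := hfree _ (by
      change ‖φ a‖ < δ
      rw [ha, norm_zero]; exact hδ)
    exact this
  let L : Submodule ℤ V := LinearMap.range φ.toIntLinearMap
  have : DiscreteTopology L := by
    refine DiscreteTopology.of_forall_le_norm hδ ?_
    rintro ⟨_, a, rfl⟩ hne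
    by_contra hlt
    push Not at hlt
    apply hne
    have : a.toMul = 1 := hfree _ hlt
    have ha : a = 0 := this
    ext
    simp [ha]
  let e : Additive H ≃ₗ[ℤ] L := LinearEquiv.ofInjective φ.toIntLinearMap hinj
  have : Module.Free ℤ (Additive H) := Module.Free.of_equiv e.symm
  let b := Module.Free.chooseBasis ℤ (Additive H)
  exact ⟨Module.Free.ChooseBasisIndex ℤ (Additive H),
    ⟨(AddEquiv.toMultiplicative b.repr.toAddEquiv : Multiplicative (Additive H) ≃* _)⟩⟩

/-- Isometries of a normed space that compose like the elements of a group form an affine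
isometric action. -/
theorem exists_of_isometries {H : Type*} [Group H] {V : Type*} [NormedAddCommGroup V]
    [NormedSpace ℝ V] (T : H → V → V) (hone : ∀ v, T 1 v = v)
    (hmul : ∀ g h v, T (g * h) v = T g (T h v)) (hiso : ∀ g, Isometry (T g)) :
    ∃ ρ : AffineIsometricAction H V, ∀ h v, ρ.lin h v + ρ.trans h = T h v := by
  let E : H → (V ≃ᵢ V) := fun g => IsometryEquiv.mk' (T g) (T g⁻¹)
    (fun v => by rw [← hmul, mul_inv_cancel, hone]) (hiso g)
  -- Mazur–Ulam: a surjective isometry of a real normed space is affine. Surjectivity comes from the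
  -- inverse `T g⁻¹`.
  let A : H → (V ≃ₗᵢ[ℝ] V) := fun g => (E g).toRealAffineIsometryEquiv.linearIsometryEquiv
  have hA : ∀ g v w, A g (v - w) = T g v - T g w := fun g v w => by
    have := (E g).toRealAffineIsometryEquiv.map_vsub v w
    exact this
  have hA0 : ∀ g v, A g v = T g v - T g 0 := fun g v => by simpa using hA g v 0
  let lin : H →* (V →L[ℝ] V) :=
    { toFun := fun g => (A g).toContinuousLinearEquiv
      map_one' := by
        ext v
        simp [hA0, hone]
      map_mul' := fun g h => by
        ext v
        change A (g * h) v = A g (A h v)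
        rw [hA0, hA0 h, hA, hmul, hmul] }
  refine ⟨⟨lin, fun g => T g 0, fun h v => (A h).norm_map v, fun g h => ?_⟩, fun h v => ?_⟩
  · change T (g * h) 0 = A g (T h 0) + T g 0
    rw [hA0, hmul]; abel
  · change A h v + T h 0 = T h v
    rw [hA0]; abel

end AffineIsometricAction

/-! ### CSA groups -/

theorem exists_maximal_abelian {G : Type*} [Group G] {a b : G} (hab : Commute a b) :
    ∃ A : Subgroup G, Maximal (fun H : Subgroup G => IsMulCommutative H) A ∧ a ∈ A ∧ b ∈ A := by
  have hcl : IsMulCommutative (Subgroup.closure {a, b}) := by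
    refine Subgroup.isMulCommutative_closure ?_
    rintro x (rfl | rfl) y (rfl | rfl)
    exacts [rfl, hab, hab.symm, rfl]
  have hub : ∀ c ⊆ {H : Subgroup G | IsMulCommutative H}, IsChain (· ≤ ·) c → ∀ y ∈ c,
      ∃ ub ∈ {H : Subgroup G | IsMulCommutative H}, ∀ z ∈ c, z ≤ ub := by
    intro c hc hchain y hy
    refine ⟨sSup c, ?_, fun z hz => le_sSup hz⟩
    refine IsMulCommutative.of_setLike_mul_comm fun x hx z hz => ?_
    rw [Subgroup.mem_sSup_of_directedOn ⟨y, hy⟩ hchain.directedOn] at hx hz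
    obtain ⟨s, hs, hxs⟩ := hx
    obtain ⟨t, ht, hzt⟩ := hz
    rcases hchain.total hs ht with hst | hst
    · have : IsMulCommutative t := hc ht
      exact setLike_mul_comm (hst hxs) hzt
    · have : IsMulCommutative s := hc hs
      exact setLike_mul_comm hxs (hst hzt)
  obtain ⟨A, hle, hA⟩ := zorn_le_nonempty₀ _ hub _ hcl
  exact ⟨A, hA, hle (Subgroup.subset_closure (by simp)), hle (Subgroup.subset_closure (by simp))⟩

theorem IsMalnormal.mem_of_conj_mem {G : Type*} [Group G] {K : Subgroup G} (hK : IsMalnormal K)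
    {g x : G} (hx : x ∈ K) (hx1 : x ≠ 1) (hgx : g * x * g⁻¹ ∈ K) : g ∈ K := by
  by_contra hg
  have h1 : g * x * g⁻¹ ∈ K.map (MulAut.conj g).toMonoidHom ⊓ K :=
    ⟨⟨x, hx, rfl⟩, hgx⟩
  rw [hK g hg, Subgroup.mem_bot] at h1
  exact hx1 (by simpa using h1)

/-- In a CSA group, commutation is transitive on non-trivial elements. -/
theorem IsCSA.commute_trans {G : Type*} [Group G] (hG : IsCSA G) {a b c : G} (hb : b ≠ 1)
    (hab : Commute a b) (hbc : Commute b c) : Commute a c := by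
  obtain ⟨A, hA, ha, hbA⟩ := exists_maximal_abelian hab
  have hc : c ∈ A := (hG A hA).mem_of_conj_mem hbA hb (by
    rw [← hbc.eq, mul_inv_cancel_right]; exact hbA)
  have : IsMulCommutative A := hA.prop
  exact setLike_mul_comm ha hc

/-! ### Stabilisers of flats -/

section Action

variable {Γ : Type u} [Group Γ] {X : Type v} [MetricSpace X] [MulAction Γ X]

theorem IsProperCocompactAction.isIsometricSMul (h : IsProperCocompactAction Γ X) :
    IsIsometricSMul Γ X := ⟨h.isometry⟩

theorem IsProperCocompactAction.finite_near (h : IsProperCocompactAction Γ X) (x : X) :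
    ∃ r > 0, {g : Γ | dist (g • x) x < r}.Finite := by
  obtain ⟨r, hr, hfin⟩ := h.proper x
  refine ⟨r, hr, hfin.subset fun g hg => ⟨g • x, ?_, hg⟩⟩
  exact Set.smul_mem_smul_set (Metric.mem_ball_self hr)

/-- Properness makes point stabilisers finite, so a torsion-free group acts freely. -/
theorem IsProperCocompactAction.eq_one_of_smul_eq (h : IsProperCocompactAction Γ X)
    (tf : ∀ g : Γ, g ≠ 1 → ¬ IsOfFinOrder g) {g : Γ} {x : X} (hg : g • x = x) : g = 1 := by
  obtain ⟨r, hr, hfin⟩ := h.finite_near x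
  by_contra hne
  refine tf g hne (finite_powers.1 (hfin.subset ?_))
  rintro _ ⟨n, rfl⟩
  have : g ^ n • x = x := by
    induction n with
    | zero => simp
    | succ n ih => rw [pow_succ, mul_smul, hg, ih]
  change dist (g ^ n • x) x < r
  rw [this, dist_self]; exact hr

theorem IsProperCocompactAction.exists_free_ball (h : IsProperCocompactAction Γ X)
    (tf : ∀ g : Γ, g ≠ 1 → ¬ IsOfFinOrder g) (x : X) :
    ∃ δ > 0, ∀ g : Γ, dist (g • x) x < δ → g = 1 := by
  obtain ⟨r, hr, hfin⟩ := h.finite_near x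
  have hfin' : ((fun g : Γ => g • x) '' {g : Γ | dist (g • x) x < r} \ {x}).Finite :=
    (hfin.image _).subset Set.sdiff_subset
  have hopen := hfin'.isClosed.isOpen_compl
  obtain ⟨ε, hε, hball⟩ := Metric.isOpen_iff.1 hopen x (by simp)
  refine ⟨min r ε, lt_min hr hε, fun g hg => h.eq_one_of_smul_eq tf (x := x) ?_⟩
  by_contra hne
  exact hball (Metric.mem_ball.2 (hg.trans_le (min_le_right _ _)))
    ⟨⟨g, hg.trans_le (min_le_left _ _), rfl⟩, hne⟩

/-- A group that preserves an isometrically embedded normed space acts on it by affine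
isometries. -/
theorem exists_affineIsometricAction_of_invariant [IsIsometricSMul Γ X] (H : Subgroup Γ)
    {V : Type*} [NormedAddCommGroup V] [NormedSpace ℝ V] {f : V → X} (hf : Isometry f)
    (hH : ∀ h ∈ H, ∀ v, h • f v ∈ Set.range f) :
    ∃ ρ : AffineIsometricAction H V, ∀ (h : H) v, f (ρ.lin h v + ρ.trans h) = (h : Γ) • f v := by
  choose T hT using fun (h : H) v => hH h h.2 v
  obtain ⟨ρ, hρ⟩ := AffineIsometricAction.exists_of_isometries T
    (fun v => hf.injective (by rw [hT]; simp))
    (fun g h v => hf.injective (by rw [hT, hT, hT, Subgroup.coe_mul, mul_smul]))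
    (fun g => Isometry.of_dist_eq fun v w => by
      rw [← hf.dist_eq, hT, hT, dist_smul, hf.dist_eq])
  exact ⟨ρ, fun h v => by rw [hρ, hT]⟩

/-- If a torsion-free CSA group acts properly, then the stabilisers of flats are free abelian. -/
theorem isFreeAbelian_stabilizer_of_isCSA (h : IsProperCocompactAction Γ X)
    (tf : ∀ g : Γ, g ≠ 1 → ¬ IsOfFinOrder g) (hcsa : IsCSA Γ) {E : Set X} (hE : IsFlat E) :
    IsFreeAbelian (MulAction.stabilizer Γ E) := by
  have := h.isIsometricSMul
  obtain ⟨k, -, f, hf, rfl⟩ := hE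
  obtain ⟨ρ, hρ⟩ := exists_affineIsometricAction_of_invariant
    (MulAction.stabilizer Γ (Set.range f)) hf (fun g hg v => by
      rw [MulAction.mem_stabilizer_iff] at hg
      rw [← hg]
      exact Set.smul_mem_smul_set ⟨v, rfl⟩)
  have hdisc : ∀ v, ρ.IsDiscreteFreeAt v := by
    intro v
    obtain ⟨δ, hδ, hfree⟩ := h.exists_free_ball tf (f v)
    refine ⟨δ, hδ, fun g hg => Subtype.ext (hfree g ?_)⟩
    rwa [← hρ, hf.dist_eq, dist_eq_norm]
  refine AffineIsometricAction.isFreeAbelian_of_commute hdisc fun a b => ?_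
  have tfH : ∀ (x : MulAction.stabilizer Γ (Set.range f)) (n : ℕ), 0 < n → x ≠ 1 →
      ((x ^ n : MulAction.stabilizer Γ (Set.range f)) : Γ) ≠ 1 := by
    intro x n hn hx he
    refine tf x (by simpa using hx) (isOfFinOrder_iff_pow_eq_one.2 ⟨n, hn, ?_⟩)
    simpa using he
  by_cases ha : a = 1
  · simp [ha]
  by_cases hb : b = 1
  · simp [hb]
  -- Commutation is carried along the chain a, a^m, b^n, b, whose inner terms are non-trivial
  -- because there is no torsion.
  obtain ⟨m, hm, hma⟩ := AffineIsometricAction.exists_pow_small (ρ := ρ) a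
  obtain ⟨n, hn, hnb⟩ := AffineIsometricAction.exists_pow_small (ρ := ρ) b
  have hc := AffineIsometricAction.commute_of_small (hdisc 0) hma hnb
  have hc' : Commute ((a ^ m : MulAction.stabilizer Γ (Set.range f)) : Γ)
      ((b ^ n : MulAction.stabilizer Γ (Set.range f)) : Γ) := by
    have := congrArg (Subtype.val) hc.eq
    exact this
  have h1 : Commute (a : Γ) ((a ^ m : MulAction.stabilizer Γ (Set.range f)) : Γ) := by
    rw [Subgroup.coe_pow]; exact Commute.self_pow _ _
  have h2 : Commute ((b ^ n : MulAction.stabilizer Γ (Set.range f)) : Γ) (b : Γ) := by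
    rw [Subgroup.coe_pow]; exact Commute.pow_self _ _
  have h3 := hcsa.commute_trans (tfH a m hm ha) h1 hc'
  have h4 := hcsa.commute_trans (tfH b n hn hb) h3 h2
  exact Subtype.ext h4.eq

end Action

/-! ### Geodesics and the CN inequality in CAT(0) spaces -/

theorem exists_comparison_triangle {a b c : ℝ} (ha : 0 ≤ a) (hb : 0 ≤ b) (hc : 0 ≤ c)
    (h1 : a ≤ b + c) (h2 : b ≤ a + c) (h3 : c ≤ a + b) :
    ∃ x y z : EPlane, dist x y = a ∧ dist x z = b ∧ dist y z = c := by
  have hd : ∀ p q r s : ℝ, dist (!₂[p, q] : EPlane) !₂[r, s] = √((p - r) ^ 2 + (q - s) ^ 2) := by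
    intro p q r s
    simp [EuclideanSpace.dist_eq, Fin.sum_univ_two, Real.dist_eq, sq_abs]
  rcases ha.eq_or_lt with rfl | ha
  · have hbc : b = c := by linarith
    refine ⟨!₂[0, 0], !₂[0, 0], !₂[b, 0], ?_, ?_, ?_⟩
    · simp
    · rw [hd]; simp [Real.sqrt_sq hb]
    · rw [hd]; simp [hbc, Real.sqrt_sq hc]
  -- By the law of cosines m is the first coordinate of the third vertex; |m| ≤ b is the triangle
  -- inequality.
  · set m := (a ^ 2 + b ^ 2 - c ^ 2) / (2 * a) with hm
    have hma : 2 * a * m = a ^ 2 + b ^ 2 - c ^ 2 := by rw [hm]; field_simp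
    have hmb : m ^ 2 ≤ b ^ 2 := by
      have hle : |2 * a * m| ≤ 2 * a * b := by
        rw [hma, abs_le]; constructor <;> nlinarith
      rw [abs_mul, abs_of_pos (by linarith : 0 < 2 * a)] at hle
      have : |m| ≤ b := le_of_mul_le_mul_left hle (by linarith)
      rw [← sq_abs m]
      exact pow_le_pow_left₀ (abs_nonneg m) this 2
    have hs := Real.sq_sqrt (sub_nonneg.2 hmb)
    refine ⟨!₂[0, 0], !₂[a, 0], !₂[m, √(b ^ 2 - m ^ 2)], ?_, ?_, ?_⟩
    · rw [hd]; simp [Real.sqrt_sq ha.le]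
    · rw [hd, zero_sub, zero_sub, neg_sq, neg_sq, hs, add_sub_cancel, Real.sqrt_sq hb]
    · rw [hd, zero_sub, neg_sq, hs]
      rw [show (a - m) ^ 2 + (b ^ 2 - m ^ 2) = c ^ 2 by nlinarith, Real.sqrt_sq hc]

theorem dist_sq_lineMap {V : Type*} [NormedAddCommGroup V] [InnerProductSpace ℝ V] (x y z : V)
    (t : ℝ) : dist z (AffineMap.lineMap x y t) ^ 2 =
      (1 - t) * dist z x ^ 2 + t * dist z y ^ 2 - t * (1 - t) * dist x y ^ 2 := by
  have e1 : z - AffineMap.lineMap x y t = (1 - t) • (z - x) + t • (z - y) := by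
    rw [AffineMap.lineMap_apply_module]; module
  have e2 : x - y = (z - y) - (z - x) := by abel
  rw [dist_eq_norm, dist_eq_norm, dist_eq_norm, dist_eq_norm, e1, e2]
  generalize z - x = a
  generalize z - y = b
  rw [norm_add_sq_real, norm_sub_sq_real, norm_smul, norm_smul, inner_smul_left,
    inner_smul_right, mul_pow, mul_pow, Real.norm_eq_abs, Real.norm_eq_abs, sq_abs, sq_abs,
    real_inner_comm a b]
  simp only [conj_trivial]
  ring

section CAT0

variable {X : Type v} [MetricSpace X]

theorem IsGeodesicSegment.exists_mem {x y : X} {S : Set X} (hS : IsGeodesicSegment x y S) {t : ℝ}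
    (ht : t ∈ Set.Icc (0 : ℝ) 1) :
    ∃ p ∈ S, dist x p = t * dist x y ∧ dist p y = (1 - t) * dist x y := by
  obtain ⟨c, hc0, hc1, hc, rfl⟩ := hS
  have hd := dist_nonneg (x := x) (y := y)
  have hmem : t * dist x y ∈ Set.Icc 0 (dist x y) :=
    ⟨mul_nonneg ht.1 hd, mul_le_of_le_one_left hd ht.2⟩
  have h1 := hc 0 ⟨le_rfl, hd⟩ _ hmem
  have h2 := hc _ hmem _ ⟨hd, le_rfl⟩
  rw [hc0, zero_sub, abs_neg, abs_of_nonneg hmem.1] at h1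
  rw [hc1, abs_sub_comm, abs_of_nonneg (by linarith [hmem.2])] at h2
  exact ⟨_, ⟨_, hmem, rfl⟩, h1, by rw [h2]; ring⟩

/-- The CN inequality: comparison of p with the vertex z, combined with Stewart's formula
`dist_sq_lineMap`. One p serves all z, which yields uniqueness in `IsCAT0.eq_geo`. -/
theorem IsCAT0.exists_geo (hX : IsCAT0 X) (x y : X) {t : ℝ} (ht : t ∈ Set.Icc (0 : ℝ) 1) :
    ∃ p, dist x p = t * dist x y ∧ dist p y = (1 - t) * dist x y ∧
      ∀ z, dist z p ^ 2 ≤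
        (1 - t) * dist z x ^ 2 + t * dist z y ^ 2 - t * (1 - t) * dist x y ^ 2 := by
  obtain ⟨S, hS⟩ := hX.geodesic x y
  obtain ⟨p, hpS, hxp, hpy⟩ := hS.exists_mem ht
  refine ⟨p, hxp, hpy, ?_⟩
  intro z
  obtain ⟨x', y', z', h1, h2, h3⟩ := exists_comparison_triangle
    (dist_nonneg (x := x) (y := y)) (dist_nonneg (x := x) (y := z))
    (dist_nonneg (x := y) (y := z))
    (by rw [dist_comm y z]; exact dist_triangle _ _ _) (dist_triangle _ _ _)
    (by rw [dist_comm x y]; exact dist_triangle _ _ _)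
  obtain ⟨Sxz, hSxz⟩ := hX.geodesic x z
  obtain ⟨Syz, hSyz⟩ := hX.geodesic y z
  have hz : z ∈ Sxz := by
    obtain ⟨d, -, hd1, -, rfl⟩ := hSxz
    exact ⟨_, ⟨dist_nonneg, le_rfl⟩, hd1⟩
  have := hX.comparison x y z S Sxz Syz hS hSxz hSyz x' y' z' h1 h2 h3
    p hpS z hz (AffineMap.lineMap x' y' t)
    (by rw [segment_eq_image_lineMap]; exact ⟨t, ht, rfl⟩) z' (right_mem_segment ℝ x' z')
    (by rw [dist_left_lineMap, Real.norm_of_nonneg ht.1, h1, hxp]) h2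
  rw [dist_comm, ← h1, dist_comm z x, dist_comm z y, ← h2, ← h3, dist_comm x' z',
    dist_comm y' z', ← dist_sq_lineMap, dist_comm z']
  exact pow_le_pow_left₀ dist_nonneg this 2

open Classical in
/-- The point dividing the geodesic from `x` to `y` in the ratio `t : 1 - t`, for
`0 ≤ t ≤ 1`. -/
noncomputable def IsCAT0.geo (hX : IsCAT0 X) (x y : X) (t : ℝ) : X :=
  if ht : t ∈ Set.Icc (0 : ℝ) 1 then (hX.exists_geo x y ht).choose else x

theorem IsCAT0.dist_left_geo (hX : IsCAT0 X) (x y : X) {t : ℝ} (ht : t ∈ Set.Icc (0 : ℝ) 1) :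
    dist x (hX.geo x y t) = t * dist x y := by
  rw [IsCAT0.geo, dif_pos ht]; exact (hX.exists_geo x y ht).choose_spec.1

theorem IsCAT0.dist_geo_right (hX : IsCAT0 X) (x y : X) {t : ℝ} (ht : t ∈ Set.Icc (0 : ℝ) 1) :
    dist (hX.geo x y t) y = (1 - t) * dist x y := by
  rw [IsCAT0.geo, dif_pos ht]; exact (hX.exists_geo x y ht).choose_spec.2.1

theorem IsCAT0.dist_sq_geo_le (hX : IsCAT0 X) (x y z : X) {t : ℝ}
    (ht : t ∈ Set.Icc (0 : ℝ) 1) : dist z (hX.geo x y t) ^ 2 ≤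
      (1 - t) * dist z x ^ 2 + t * dist z y ^ 2 - t * (1 - t) * dist x y ^ 2 := by
  rw [IsCAT0.geo, dif_pos ht]; exact (hX.exists_geo x y ht).choose_spec.2.2 z

/-- With p itself as test point the right-hand side of the CN inequality vanishes. -/
theorem IsCAT0.eq_geo (hX : IsCAT0 X) {x y p : X} {t : ℝ} (ht : t ∈ Set.Icc (0 : ℝ) 1)
    (h1 : dist x p = t * dist x y) (h2 : dist p y = (1 - t) * dist x y) : p = hX.geo x y t := by
  have := hX.dist_sq_geo_le x y p ht
  rw [dist_comm p x, h1, h2] at this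
  have h0 : dist p (hX.geo x y t) ^ 2 ≤ 0 := by
    refine this.trans (le_of_eq ?_); ring
  exact dist_eq_zero.1 (pow_eq_zero_iff two_ne_zero |>.1 (le_antisymm h0 (sq_nonneg _)))

theorem IsCAT0.geo_symm (hX : IsCAT0 X) (x y : X) {t : ℝ} (ht : t ∈ Set.Icc (0 : ℝ) 1) :
    hX.geo y x (1 - t) = hX.geo x y t := by
  have ht' : 1 - t ∈ Set.Icc (0 : ℝ) 1 := ⟨by linarith [ht.2], by linarith [ht.1]⟩
  refine hX.eq_geo ht ?_ ?_
  · rw [dist_comm, hX.dist_geo_right _ _ ht', dist_comm y x]; ring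
  · rw [dist_comm, hX.dist_left_geo _ _ ht', dist_comm y x]

theorem IsCAT0.dist_geo_geo_le_of_left (hX : IsCAT0 X) (x y z : X) {t : ℝ}
    (ht : t ∈ Set.Icc (0 : ℝ) 1) : dist (hX.geo x y t) (hX.geo x z t) ≤ t * dist y z := by
  obtain ⟨x', y', z', h1, h2, h3⟩ := exists_comparison_triangle
    (dist_nonneg (x := x) (y := y)) (dist_nonneg (x := x) (y := z))
    (dist_nonneg (x := y) (y := z))
    (by rw [dist_comm y z]; exact dist_triangle _ _ _) (dist_triangle _ _ _)
    (by rw [dist_comm x y]; exact dist_triangle _ _ _)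
  have mem : ∀ (w : X) (S : Set X), IsGeodesicSegment x w S → hX.geo x w t ∈ S := by
    intro w S hS
    obtain ⟨p, hpS, h1, h2⟩ := hS.exists_mem ht
    rwa [← hX.eq_geo ht h1 h2]
  obtain ⟨Sxy, hSxy⟩ := hX.geodesic x y
  obtain ⟨Sxz, hSxz⟩ := hX.geodesic x z
  obtain ⟨Syz, hSyz⟩ := hX.geodesic y z
  have := hX.comparison x y z Sxy Sxz Syz hSxy hSxz hSyz x' y' z' h1 h2 h3
    _ (mem y _ hSxy) _ (mem z _ hSxz) (AffineMap.lineMap x' y' t)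
    (by rw [segment_eq_image_lineMap]; exact ⟨t, ht, rfl⟩) (AffineMap.lineMap x' z' t)
    (by rw [segment_eq_image_lineMap]; exact ⟨t, ht, rfl⟩)
    (by rw [dist_left_lineMap, Real.norm_of_nonneg ht.1, h1, hX.dist_left_geo _ _ ht])
    (by rw [dist_left_lineMap, Real.norm_of_nonneg ht.1, h2, hX.dist_left_geo _ _ ht])
  refine this.trans (le_of_eq ?_)
  rw [← h3, dist_eq_norm, dist_eq_norm, AffineMap.lineMap_apply_module,
    AffineMap.lineMap_apply_module, add_sub_add_left_eq_sub, ← smul_sub, norm_smul,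
    Real.norm_of_nonneg ht.1]

/-- Convexity of the metric. -/
theorem IsCAT0.dist_geo_geo_le (hX : IsCAT0 X) (x y x' y' : X) {t : ℝ}
    (ht : t ∈ Set.Icc (0 : ℝ) 1) :
    dist (hX.geo x y t) (hX.geo x' y' t) ≤ (1 - t) * dist x x' + t * dist y y' := by
  have ht' : 1 - t ∈ Set.Icc (0 : ℝ) 1 := ⟨by linarith [ht.2], by linarith [ht.1]⟩
  have h1 := hX.dist_geo_geo_le_of_left x y y' ht
  have h2 := hX.dist_geo_geo_le_of_left y' x x' ht'
  rw [hX.geo_symm _ _ ht, hX.geo_symm _ _ ht] at h2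
  have := dist_triangle (hX.geo x y t) (hX.geo x y' t) (hX.geo x' y' t)
  linarith

/-- The quadrilateral inequality: the sum of the squares of the diagonals is at most the sum of
the squares of the sides. -/
theorem IsCAT0.quadrilateral (hX : IsCAT0 X) (x y y' x' : X) :
    dist x y' ^ 2 + dist y x' ^ 2 ≤
      dist x y ^ 2 + dist y y' ^ 2 + dist y' x' ^ 2 + dist x x' ^ 2 := by
  have ht : (1 / 2 : ℝ) ∈ Set.Icc (0 : ℝ) 1 := ⟨by norm_num, by norm_num⟩
  have h1 := hX.dist_sq_geo_le y x' x ht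
  have h2 := hX.dist_sq_geo_le y x' y' ht
  have h3 := dist_triangle_right x y' (hX.geo y x' (1 / 2))
  have h4 := pow_le_pow_left₀ dist_nonneg h3 2
  rw [dist_comm y' y] at h2
  nlinarith [sq_nonneg (dist x (hX.geo y x' (1 / 2)) - dist y' (hX.geo y x' (1 / 2)))]

/-- Isometric embeddings of Euclidean spaces map segments to geodesics. -/
theorem IsCAT0.isometry_lineMap (hX : IsCAT0 X) {V : Type*} [NormedAddCommGroup V]
    [NormedSpace ℝ V] {f : V → X} (hf : Isometry f) (v w : V) {t : ℝ}
    (ht : t ∈ Set.Icc (0 : ℝ) 1) :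
    f (AffineMap.lineMap v w t) = hX.geo (f v) (f w) t := by
  refine hX.eq_geo ht ?_ ?_
  · rw [hf.dist_eq, hf.dist_eq, dist_left_lineMap, Real.norm_of_nonneg ht.1]
  · rw [hf.dist_eq, hf.dist_eq, dist_lineMap_right, Real.norm_of_nonneg (by linarith [ht.2])]

/-- The CN inequality for midpoints in an isometrically embedded Euclidean space. -/
theorem IsCAT0.dist_sq_isometry_le (hX : IsCAT0 X) {V : Type*} [NormedAddCommGroup V]
    [NormedSpace ℝ V] {f : V → X} (hf : Isometry f) (z : X) (w s : V) :
    2 * dist z (f w) ^ 2 + 2 * ‖s‖ ^ 2 ≤ dist z (f (w + s)) ^ 2 + dist z (f (w - s)) ^ 2 := by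
  have ht : (1 / 2 : ℝ) ∈ Set.Icc (0 : ℝ) 1 := ⟨by norm_num, by norm_num⟩
  have h1 := hX.dist_sq_geo_le (f (w + s)) (f (w - s)) z ht
  rw [← hX.isometry_lineMap hf _ _ ht, hf.dist_eq,
    show AffineMap.lineMap (w + s) (w - s) (1 / 2 : ℝ) = w by
      rw [AffineMap.lineMap_apply_module]; module,
    show dist (w + s) (w - s) = 2 * ‖s‖ by
      rw [dist_eq_norm, show w + s - (w - s) = (2 : ℝ) • s by module, norm_smul,
        Real.norm_ofNat]] at h1
  nlinarith

end CAT0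

/-! ### Parallel flats -/

section Parallel

variable {X : Type v} [MetricSpace X] {V : Type*} [NormedAddCommGroup V]

/-- Two maps `f, f' : V → X` are parallel if together they span a product of `V` with a
segment, with corresponding points opposite to each other. -/
def Parallel (f f' : V → X) : Prop :=
  ∀ v w, dist (f v) (f' w) ^ 2 = ‖v - w‖ ^ 2 + dist (f 0) (f' 0) ^ 2

theorem Isometry.parallel_refl {f : V → X} (hf : Isometry f) : Parallel f f := fun v w => by
  rw [hf.dist_eq, dist_eq_norm, dist_self]; ring

theorem Parallel.symm {f f' : V → X} (h : Parallel f f') : Parallel f' f := fun v w => by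
  rw [dist_comm, h, norm_sub_rev, dist_comm (f 0)]

theorem Parallel.dist_eq {f f' : V → X} (h : Parallel f f') (v : V) :
    dist (f v) (f' v) = dist (f 0) (f' 0) := by
  have := h v v
  rw [sub_self, norm_zero, zero_pow two_ne_zero, zero_add] at this
  exact (pow_left_inj₀ dist_nonneg dist_nonneg two_ne_zero).1 this

theorem Parallel.dist_le {f f' : V → X} (h : Parallel f f') (v w : V) :
    dist (f 0) (f' 0) ≤ dist (f v) (f' w) := by
  refine le_of_sq_le_sq ?_ dist_nonneg
  rw [h v w]
  linarith [sq_nonneg ‖v - w‖]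

/-- The flat at ratio `t` between two parallel flats. -/
noncomputable def IsCAT0.interp (hX : IsCAT0 X) (f₁ f₂ : V → X) (t : ℝ) (v : V) : X :=
  hX.geo (f₁ v) (f₂ v) t

/-- The CN inequality gives only upper bounds; `IsCAT0.dist_sq_interp_left` turns this one into an
equality. -/
theorem IsCAT0.dist_sq_interp_le_left (hX : IsCAT0 X) {f₁ f₂ : V → X} (h₁ : Isometry f₁)
    (hp : Parallel f₁ f₂) {t : ℝ} (ht : t ∈ Set.Icc (0 : ℝ) 1) (v w : V) :
    dist (f₁ v) (hX.interp f₁ f₂ t w) ^ 2 ≤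
      ‖v - w‖ ^ 2 + t ^ 2 * dist (f₁ 0) (f₂ 0) ^ 2 := by
  have := hX.dist_sq_geo_le (f₁ w) (f₂ w) (f₁ v) ht
  rw [h₁.dist_eq, dist_eq_norm, hp v w, hp.dist_eq w] at this
  refine this.trans (le_of_eq ?_)
  ring

theorem IsCAT0.dist_sq_interp_le_right (hX : IsCAT0 X) {f₁ f₂ : V → X} (h₂ : Isometry f₂)
    (hp : Parallel f₁ f₂) {t : ℝ} (ht : t ∈ Set.Icc (0 : ℝ) 1) (v w : V) :
    dist (f₂ v) (hX.interp f₁ f₂ t w) ^ 2 ≤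
      ‖v - w‖ ^ 2 + (1 - t) ^ 2 * dist (f₁ 0) (f₂ 0) ^ 2 := by
  have := hX.dist_sq_geo_le (f₁ w) (f₂ w) (f₂ v) ht
  rw [h₂.dist_eq, dist_eq_norm, hp.symm v w, hp.dist_eq w, dist_comm (f₂ 0)] at this
  refine this.trans (le_of_eq ?_)
  ring

theorem IsCAT0.dist_sq_interp_le (hX : IsCAT0 X) {f₁ f₂ : V → X} (h₁ : Isometry f₁)
    (h₂ : Isometry f₂) (hp : Parallel f₁ f₂) {s t : ℝ} (hs : s ∈ Set.Icc (0 : ℝ) 1)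
    (ht : t ∈ Set.Icc (0 : ℝ) 1) (v w : V) :
    dist (hX.interp f₁ f₂ s v) (hX.interp f₁ f₂ t w) ^ 2 ≤
      ‖v - w‖ ^ 2 + (s - t) ^ 2 * dist (f₁ 0) (f₂ 0) ^ 2 := by
  have a := hX.dist_sq_geo_le (f₁ v) (f₂ v) (hX.interp f₁ f₂ t w) hs
  have b := hX.dist_sq_interp_le_left h₁ hp ht v w
  have c := hX.dist_sq_interp_le_right h₂ hp ht v w
  rw [dist_comm _ (f₁ v), dist_comm _ (f₂ v), hp.dist_eq] at a
  rw [dist_comm]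
  change dist (hX.interp f₁ f₂ t w) (hX.interp f₁ f₂ s v) ^ 2 ≤ _ at a
  have b' := mul_le_mul_of_nonneg_left b (by linarith [hs.2] : 0 ≤ 1 - s)
  have c' := mul_le_mul_of_nonneg_left c hs.1
  nlinarith

theorem IsCAT0.dist_interp_self (hX : IsCAT0 X) {f₁ f₂ : V → X} (h₁ : Isometry f₁)
    (h₂ : Isometry f₂) (hp : Parallel f₁ f₂) {s t : ℝ} (hs : s ∈ Set.Icc (0 : ℝ) 1)
    (ht : t ∈ Set.Icc (0 : ℝ) 1) (v : V) :
    dist (hX.interp f₁ f₂ s v) (hX.interp f₁ f₂ t v) ^ 2 =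
      (s - t) ^ 2 * dist (f₁ 0) (f₂ 0) ^ 2 := by
  refine le_antisymm (by simpa using hX.dist_sq_interp_le h₁ h₂ hp hs ht v v) ?_
  wlog hst : s ≤ t generalizing s t
  · have := this ht hs (le_of_not_ge hst)
    rw [dist_comm (hX.interp f₁ f₂ t v)] at this
    refine le_trans (le_of_eq ?_) this
    ring
  have a := hX.dist_left_geo (f₁ v) (f₂ v) hs
  have b := hX.dist_geo_right (f₁ v) (f₂ v) ht
  have c := dist_triangle4 (f₁ v) (hX.interp f₁ f₂ s v) (hX.interp f₁ f₂ t v) (f₂ v)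
  rw [IsCAT0.interp, IsCAT0.interp, a, b, hp.dist_eq] at c
  have d : (t - s) * dist (f₁ 0) (f₂ 0) ≤
      dist (hX.interp f₁ f₂ s v) (hX.interp f₁ f₂ t v) := by
    rw [IsCAT0.interp, IsCAT0.interp]; linarith
  have := pow_le_pow_left₀ (mul_nonneg (by linarith) dist_nonneg) d 2
  refine le_trans (le_of_eq ?_) this
  ring

variable [NormedSpace ℝ V]

/-- A convex function on a real vector space that is bounded above is constant. -/
theorem eq_of_convex_of_bounded {φ : V → ℝ} {M : ℝ}
    (hconv : ∀ v w, ∀ t ∈ Set.Icc (0 : ℝ) 1,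
      φ (AffineMap.lineMap v w t) ≤ (1 - t) * φ v + t * φ w)
    (hM : ∀ v, φ v ≤ M) (v w : V) : φ v = φ w := by
  have key : ∀ v w, φ w ≤ φ v := by
    intro v w
    by_contra! hlt
    have hMv : φ v < M := hlt.trans_le (hM w)
    -- The ray from v through w is continued by the factor 1/t; with this t, convexity and the bound
    -- M give φ w - φ v ≤ (φ w - φ v)/2.
    set t := (φ w - φ v) / (2 * (M - φ v)) with ht
    have hpos : 0 < 2 * (M - φ v) := by linarith
    have ht0 : 0 < t := div_pos (by linarith) hpos
    have ht1 : t ≤ 1 := by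
      rw [ht, div_le_one hpos]; linarith [hM w]
    have htm : t * (M - φ v) = (φ w - φ v) / 2 := by
      rw [ht]; rw [div_mul_eq_mul_div, div_eq_div_iff hpos.ne' two_ne_zero]; ring
    have h1 := hconv v (v + t⁻¹ • (w - v)) t ⟨ht0.le, ht1⟩
    have e : AffineMap.lineMap v (v + t⁻¹ • (w - v)) t = w := by
      rw [AffineMap.lineMap_apply_module', add_sub_cancel_left, smul_smul, mul_inv_cancel₀ ht0.ne',
        one_smul, sub_add_cancel]
    rw [e] at h1
    have h2 := mul_le_mul_of_nonneg_left (hM (v + t⁻¹ • (w - v))) ht0.le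
    linarith
  exact le_antisymm (key w v) (key v w)

/-- As a function of v the distance is convex and bounded by C + ‖w‖, hence constant. -/
theorem IsCAT0.dist_translate (hX : IsCAT0 X) {f f' : V → X} (hf : Isometry f) (hf' : Isometry f')
    {C : ℝ} (hC : ∀ v, dist (f v) (f' v) ≤ C) (v w : V) :
    dist (f v) (f' (v + w)) = dist (f 0) (f' w) := by
  have := eq_of_convex_of_bounded (φ := fun v => dist (f v) (f' (v + w))) (M := C + ‖w‖)
    (fun v v' t ht => by
      have e : AffineMap.lineMap v v' t + w = AffineMap.lineMap (v + w) (v' + w) t := by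
        rw [AffineMap.lineMap_apply_module, AffineMap.lineMap_apply_module]; module
      simp only [e, hX.isometry_lineMap hf _ _ ht, hX.isometry_lineMap hf' _ _ ht]
      exact hX.dist_geo_geo_le _ _ _ _ ht)
    (fun v => by
      refine (dist_triangle _ (f' v) _).trans (add_le_add (hC v) ?_)
      rw [hf'.dist_eq, dist_eq_norm, sub_add_cancel_left, norm_neg]) v 0
  simpa using this

/-- One inequality is CN along f'. The other is the quadrilateral inequality for f 0, f s, f' (w +
s), f' w, with a diagonal and a side rewritten by `IsCAT0.dist_translate`. -/
theorem IsCAT0.dist_sq_add_dist_sq (hX : IsCAT0 X) {f f' : V → X} (hf : Isometry f)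
    (hf' : Isometry f') {C : ℝ} (hC : ∀ v, dist (f v) (f' v) ≤ C) (w s : V) :
    dist (f 0) (f' (w + s)) ^ 2 + dist (f 0) (f' (w - s)) ^ 2 =
      2 * dist (f 0) (f' w) ^ 2 + 2 * ‖s‖ ^ 2 := by
  refine le_antisymm ?_ (hX.dist_sq_isometry_le hf' _ _ _)
  have h1 := hX.quadrilateral (f 0) (f s) (f' (w + s)) (f' w)
  have e1 : dist (f s) (f' w) = dist (f 0) (f' (w - s)) := by
    rw [← hX.dist_translate hf hf' hC s (w - s), add_sub_cancel]
  have e2 : dist (f s) (f' (w + s)) = dist (f 0) (f' w) := by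
    rw [← hX.dist_translate hf hf' hC s w, add_comm]
  rw [e1, e2, hf.dist_eq, hf'.dist_eq, dist_eq_norm, dist_eq_norm, zero_sub, norm_neg,
    add_sub_cancel_left] at h1
  linarith

/-- The deviation of `f'` from being parallel to `f`. -/
noncomputable def parallelDefect (f f' : V → X) (w : V) : ℝ :=
  dist (f 0) (f' w) ^ 2 - ‖w‖ ^ 2 - dist (f 0) (f' 0) ^ 2

/-- The parallelogram identity makes the defect odd and homogeneous under doubling. One-sided bounds
at large or small scale therefore force it to vanish. -/
theorem IsCAT0.parallelDefect_neg (hX : IsCAT0 X) {f f' : V → X} (hf : Isometry f)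
    (hf' : Isometry f') {C : ℝ} (hC : ∀ v, dist (f v) (f' v) ≤ C) (w : V) :
    parallelDefect f f' (-w) = - parallelDefect f f' w := by
  have := hX.dist_sq_add_dist_sq hf hf' hC 0 w
  rw [zero_add, zero_sub] at this
  rw [parallelDefect, parallelDefect, norm_neg]
  linarith

theorem IsCAT0.parallelDefect_two_pow_smul (hX : IsCAT0 X) {f f' : V → X} (hf : Isometry f)
    (hf' : Isometry f') {C : ℝ} (hC : ∀ v, dist (f v) (f' v) ≤ C) (n : ℕ) (w : V) :
    parallelDefect f f' ((2 : ℝ) ^ n • w) = 2 ^ n * parallelDefect f f' w := by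
  induction n with
  | zero => simp
  | succ n ih =>
    have h1 : ∀ w, parallelDefect f f' ((2 : ℝ) • w) = 2 * parallelDefect f f' w := by
      intro w
      have := hX.dist_sq_add_dist_sq hf hf' hC w w
      rw [sub_self, ← two_smul ℝ w] at this
      rw [parallelDefect, parallelDefect, norm_smul, mul_pow, Real.norm_ofNat]
      linarith
    rw [pow_succ', mul_smul, h1, ih]; ring

theorem IsCAT0.parallel_of_parallelDefect_nonpos (hX : IsCAT0 X) {f f' : V → X} (hf : Isometry f)
    (hf' : Isometry f') {C : ℝ} (hC : ∀ v, dist (f v) (f' v) ≤ C)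
    (h : ∀ w, parallelDefect f f' w ≤ 0) : Parallel f f' := by
  intro v w
  have h1 := h (w - v)
  have h2 := h (-(w - v))
  rw [hX.parallelDefect_neg hf hf' hC] at h2
  have h3 : parallelDefect f f' (w - v) = 0 := by linarith
  have h4 := hX.dist_translate hf hf' hC v (w - v)
  rw [add_sub_cancel] at h4
  rw [parallelDefect] at h3
  rw [h4, norm_sub_rev]
  linarith

theorem IsCAT0.parallel_of_bounded (hX : IsCAT0 X) {f f' : V → X} (hf : Isometry f)
    (hf' : Isometry f') {C M : ℝ} (hC : ∀ v, dist (f v) (f' v) ≤ C)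
    (hM : ∀ w, dist (f 0) (f' w) ^ 2 ≤ ‖w‖ ^ 2 + M) : Parallel f f' := by
  refine hX.parallel_of_parallelDefect_nonpos hf hf' hC fun w => ?_
  by_contra! hpos
  obtain ⟨n, hn⟩ := pow_unbounded_of_one_lt (M / parallelDefect f f' w) one_lt_two
  rw [div_lt_iff₀ hpos, ← hX.parallelDefect_two_pow_smul hf hf' hC, parallelDefect] at hn
  have := hM ((2 : ℝ) ^ n • w)
  linarith [sq_nonneg (dist (f 0) (f' 0))]

/-- Minimality at 0 bounds the defect below by -‖u‖². Under u = w/2^n the defect scales like 2^-n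
but this bound like 4^-n, so the defect cannot be negative. -/
theorem IsCAT0.parallel_of_le (hX : IsCAT0 X) {f f' : V → X} (hf : Isometry f)
    (hf' : Isometry f') {C : ℝ} (hC : ∀ v, dist (f v) (f' v) ≤ C)
    (hle : ∀ w, dist (f 0) (f' 0) ≤ dist (f 0) (f' w)) : Parallel f f' := by
  have hnonneg : ∀ w, 0 ≤ parallelDefect f f' w := by
    intro w
    by_contra! hneg
    obtain ⟨n, hn⟩ := pow_unbounded_of_one_lt (‖w‖ ^ 2 / - parallelDefect f f' w) one_lt_two
    rw [div_lt_iff₀ (by linarith)] at hn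
    have e : w = (2 : ℝ) ^ n • (((2 : ℝ) ^ n)⁻¹ • w) := by
      rw [smul_smul, mul_inv_cancel₀ (by positivity), one_smul]
    set u := ((2 : ℝ) ^ n)⁻¹ • w with hu
    have h1 := hX.parallelDefect_two_pow_smul hf hf' hC n u
    rw [← e] at h1
    have h2 : - ‖u‖ ^ 2 ≤ parallelDefect f f' u := by
      rw [parallelDefect]
      have := pow_le_pow_left₀ dist_nonneg (hle u) 2
      linarith
    have h3 : ‖w‖ ^ 2 = (2 ^ n) ^ 2 * ‖u‖ ^ 2 := by
      conv_lhs => rw [e]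
      rw [norm_smul, mul_pow, Real.norm_of_nonneg (by positivity)]
    have hp : (0 : ℝ) < 2 ^ n := by positivity
    rw [h1, h3] at hn
    have h4 : (2 ^ n : ℝ) ^ 2 * ‖u‖ ^ 2 < (2 ^ n) ^ 2 * (- parallelDefect f f' u) := by
      linarith
    have h5 := lt_of_mul_lt_mul_left h4 (by positivity)
    linarith
  refine hX.parallel_of_parallelDefect_nonpos hf hf' hC fun w => ?_
  have := hnonneg (-w)
  rw [hX.parallelDefect_neg hf hf' hC] at this
  linarith

/-- Going from f₁ 0 to f₂ w through f₀ (w/2) costs two terms of equal horizontal length, so the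
squared distance exceeds ‖w‖² by a bounded amount only. -/
theorem IsCAT0.parallel_trans (hX : IsCAT0 X) {f₀ f₁ f₂ : V → X} (h₁ : Isometry f₁)
    (h₂ : Isometry f₂) (p₁ : Parallel f₀ f₁) (p₂ : Parallel f₀ f₂) : Parallel f₁ f₂ := by
  refine hX.parallel_of_bounded h₁ h₂
    (C := dist (f₀ 0) (f₁ 0) + dist (f₀ 0) (f₂ 0))
    (M := 2 * dist (f₀ 0) (f₁ 0) ^ 2 + 2 * dist (f₀ 0) (f₂ 0) ^ 2) (fun v => ?_) (fun w => ?_)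
  · rw [← p₁.dist_eq v, ← p₂.dist_eq v]
    exact dist_triangle_left _ _ _
  · set u := (1 / 2 : ℝ) • w
    have hw : w = (2 : ℝ) • u := by simp [u, smul_smul]
    have a1 := p₁ u 0
    have a2 := p₂ u w
    have hw' : ‖u - w‖ = ‖u‖ := by
      rw [hw, two_smul, sub_add_cancel_left, norm_neg]
    rw [sub_zero] at a1
    rw [hw'] at a2
    have hn : ‖w‖ ^ 2 = 4 * ‖u‖ ^ 2 := by
      rw [hw, norm_smul, Real.norm_ofNat]; ring
    have h3 := pow_le_pow_left₀ dist_nonneg (dist_triangle_left (f₁ 0) (f₂ w) (f₀ u)) 2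
    nlinarith [sq_nonneg (dist (f₀ u) (f₁ 0) - dist (f₀ u) (f₂ w))]

/-- Nearest point projection of a flat to another flat whose neighbourhood contains it. -/
theorem IsCAT0.exists_projection [ProperSpace X] [CompleteSpace V] (hX : IsCAT0 X)
    {f f' : V → X} (hf : Isometry f) (hf' : Isometry f') {C : ℝ}
    (hC : ∀ v, ∃ w, dist (f v) (f' w) ≤ C) :
    ∃ (p : V → V) (D : ℝ), 0 ≤ D ∧ (∀ v, dist (f v) (f' (p v)) = D) ∧
      (∀ v w, D ^ 2 + ‖p v - w‖ ^ 2 ≤ dist (f v) (f' w) ^ 2) ∧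
      ∀ v w, ‖p v - p w‖ ≤ ‖v - w‖ := by
  have hclosed : IsClosed (Set.range f') := hf'.isClosedEmbedding.isClosed_range
  have hne : (Set.range f').Nonempty := ⟨_, 0, rfl⟩
  have hex : ∀ v, ∃ w, Metric.infDist (f v) (Set.range f') = dist (f v) (f' w) := by
    intro v
    obtain ⟨_, ⟨w, rfl⟩, hw⟩ := hclosed.exists_infDist_eq_dist hne (f v)
    exact ⟨w, hw⟩
  choose p hp using hex
  have hle : ∀ v w, Metric.infDist (f v) (Set.range f') ≤ dist (f v) (f' w) := fun v w =>
    Metric.infDist_le_dist_of_mem ⟨w, rfl⟩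
  have hconst : ∀ v, Metric.infDist (f v) (Set.range f') =
      Metric.infDist (f 0) (Set.range f') := by
    intro v
    refine eq_of_convex_of_bounded (φ := fun v => Metric.infDist (f v) (Set.range f')) (M := C)
      (fun v w t ht => ?_) (fun v => ?_) v 0
    · refine (hle _ (AffineMap.lineMap (p v) (p w) t)).trans ?_
      rw [hX.isometry_lineMap hf _ _ ht, hX.isometry_lineMap hf' _ _ ht, hp, hp]
      exact hX.dist_geo_geo_le _ _ _ _ ht
    · obtain ⟨w, hw⟩ := hC v
      exact (hle v w).trans hw
  set D := Metric.infDist (f 0) (Set.range f') with hD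
  have hpD : ∀ v, dist (f v) (f' (p v)) = D := fun v => by rw [← hp, hconst]
  have hD0 : 0 ≤ D := Metric.infDist_nonneg
  have hproj : ∀ v w, D ^ 2 + ‖p v - w‖ ^ 2 ≤ dist (f v) (f' w) ^ 2 := by
    intro v w
    -- First variation at the nearest point: CN along the geodesic from p v to w, divided by t. The
    -- limit t → 0 is replaced below by an ε whose loss is half the supposed deficit.
    have h1 : ∀ t ∈ Set.Ioc (0 : ℝ) 1,
        (1 - t) * ‖p v - w‖ ^ 2 ≤ dist (f v) (f' w) ^ 2 - D ^ 2 := by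
      intro t ht
      have ht' : t ∈ Set.Icc (0 : ℝ) 1 := ⟨ht.1.le, ht.2⟩
      have a1 := hX.dist_sq_geo_le (f' (p v)) (f' w) (f v) ht'
      have a2 := hle v (AffineMap.lineMap (p v) w t)
      rw [hconst, hX.isometry_lineMap hf' _ _ ht'] at a2
      have a3 := pow_le_pow_left₀ hD0 a2 2
      rw [hpD, hf'.dist_eq, dist_eq_norm] at a1
      have a4 : t * ((1 - t) * ‖p v - w‖ ^ 2) ≤ t * (dist (f v) (f' w) ^ 2 - D ^ 2) := by
        linarith
      exact le_of_mul_le_mul_left a4 ht.1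
    by_contra! hlt
    have hN : 0 < ‖p v - w‖ ^ 2 := by
      have := h1 1 ⟨one_pos, le_rfl⟩
      linarith
    set ε := (D ^ 2 + ‖p v - w‖ ^ 2 - dist (f v) (f' w) ^ 2) / (2 * ‖p v - w‖ ^ 2) with hε
    have hε0 : 0 < ε := div_pos (by linarith) (by linarith)
    have hεN : ε * ‖p v - w‖ ^ 2 = (D ^ 2 + ‖p v - w‖ ^ 2 - dist (f v) (f' w) ^ 2) / 2 := by
      rw [hε, div_mul_eq_mul_div, div_eq_div_iff (by positivity) two_ne_zero]; ring
    have hε1 : ε ≤ 1 := by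
      rw [hε, div_le_one (by linarith)]
      have := h1 1 ⟨one_pos, le_rfl⟩
      linarith
    have := h1 ε ⟨hε0, hε1⟩
    linarith
  refine ⟨p, D, hD0, hpD, hproj, fun v w => ?_⟩
  refine le_of_sq_le_sq ?_ (norm_nonneg _)
  -- Two sides equal D, while by `hproj` each squared diagonal is at least D² + ‖p v - p w‖².
  have q1 := hX.quadrilateral (f v) (f w) (f' (p w)) (f' (p v))
  have q2 := hproj v (p w)
  have q3 := hproj w (p v)
  rw [hpD, hpD, hf.dist_eq, hf'.dist_eq, dist_eq_norm, dist_eq_norm] at q1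
  rw [norm_sub_rev (p w) (p v)] at q1 q3
  linarith

/-- Two flats at finite Hausdorff distance are parallel, after a change of parametrisation. -/
theorem IsCAT0.exists_parallel_reparam [ProperSpace X] [CompleteSpace V] (hX : IsCAT0 X)
    {f f' : V → X} (hf : Isometry f) (hf' : Isometry f') {C C' : ℝ}
    (hC : ∀ v, ∃ w, dist (f v) (f' w) ≤ C) (hC' : ∀ v, ∃ w, dist (f' v) (f w) ≤ C') :
    ∃ A : V → V, Isometry A ∧ Function.Surjective A ∧ Parallel f (f' ∘ A) := by
  obtain ⟨p, D, hD0, hpD, hp, hpl⟩ := hX.exists_projection hf hf' hC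
  obtain ⟨q, D', hD0', hqD, hq, hql⟩ := hX.exists_projection hf' hf hC'
  have hDD : D ≤ D' := by
    refine le_of_sq_le_sq ?_ hD0'
    have := hp (q 0) 0
    rw [dist_comm, hqD] at this
    linarith [sq_nonneg ‖p (q 0) - 0‖]
  have hDD' : D' ≤ D := by
    refine le_of_sq_le_sq ?_ hD0
    have := hq (p 0) 0
    rw [dist_comm, hpD] at this
    linarith [sq_nonneg ‖q (p 0) - 0‖]
  have hEq : D = D' := le_antisymm hDD hDD'
  -- With D = D', the pair v, p v also attains the distance for q, so the projections are mutually
  -- inverse; both being 1-Lipschitz, they are isometries.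
  have hqp : ∀ v, q (p v) = v := by
    intro v
    have := hq (p v) v
    rw [dist_comm, hpD, ← hEq] at this
    have h0 : ‖q (p v) - v‖ ^ 2 = 0 := le_antisymm (by linarith) (sq_nonneg _)
    exact sub_eq_zero.1 (norm_eq_zero.1 (pow_eq_zero_iff two_ne_zero |>.1 h0))
  have hpq : ∀ v, p (q v) = v := by
    intro v
    have := hp (q v) v
    rw [dist_comm, hqD, ← hEq] at this
    have h0 : ‖p (q v) - v‖ ^ 2 = 0 := le_antisymm (by linarith) (sq_nonneg _)
    exact sub_eq_zero.1 (norm_eq_zero.1 (pow_eq_zero_iff two_ne_zero |>.1 h0))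
  have hpiso : Isometry p := by
    refine Isometry.of_dist_eq fun v w => ?_
    rw [dist_eq_norm, dist_eq_norm]
    refine le_antisymm (hpl v w) ?_
    have := hql (p v) (p w)
    rwa [hqp, hqp] at this
  refine ⟨p, hpiso, fun v => ⟨q v, hpq v⟩, ?_⟩
  refine hX.parallel_of_le hf (hf'.comp hpiso) (C := D) (fun v => (hpD v).le) fun w => ?_
  refine le_of_sq_le_sq ?_ dist_nonneg
  have := hp 0 (p w)
  simp only [Function.comp]
  rw [hpD]
  linarith [sq_nonneg ‖p 0 - p w‖]

/-! ### Interpolation between parallel flats -/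

/-- Lower bound: w is the midpoint of v and its reflection 2w - v. CN for this midpoint, with the
upper bound at the reflection, bounds the distance to f₁ v from below. -/
theorem IsCAT0.dist_sq_interp_left (hX : IsCAT0 X) {f₁ f₂ : V → X} (h₁ : Isometry f₁)
    (hp : Parallel f₁ f₂) {t : ℝ} (ht : t ∈ Set.Icc (0 : ℝ) 1) (v w : V) :
    dist (f₁ v) (hX.interp f₁ f₂ t w) ^ 2 =
      ‖v - w‖ ^ 2 + t ^ 2 * dist (f₁ 0) (f₂ 0) ^ 2 := by
  refine le_antisymm (hX.dist_sq_interp_le_left h₁ hp ht v w) ?_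
  have a := hX.dist_sq_isometry_le h₁ (hX.interp f₁ f₂ t w) w (v - w)
  have b := hX.dist_sq_interp_le_left h₁ hp ht (w - (v - w)) w
  rw [add_sub_cancel, dist_comm _ (f₁ w), dist_comm _ (f₁ v), dist_comm _ (f₁ (w - (v - w)))] at a
  rw [sub_sub_cancel_left, norm_neg] at b
  have c := hX.dist_left_geo (f₁ w) (f₂ w) ht
  rw [hp.dist_eq] at c
  change dist (f₁ w) (hX.interp f₁ f₂ t w) = _ at c
  rw [c] at a
  linarith

theorem IsCAT0.isometry_interp (hX : IsCAT0 X) {f₁ f₂ : V → X} (h₁ : Isometry f₁)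
    (h₂ : Isometry f₂) (hp : Parallel f₁ f₂) {t : ℝ} (ht : t ∈ Set.Icc (0 : ℝ) 1) :
    Isometry (hX.interp f₁ f₂ t) := by
  refine Isometry.of_dist_eq fun v w => ?_
  rw [dist_eq_norm]
  refine le_antisymm ?_ ?_
  · refine le_of_sq_le_sq ?_ (norm_nonneg _)
    simpa using hX.dist_sq_interp_le h₁ h₂ hp ht ht v w
  · refine le_of_sq_le_sq ?_ dist_nonneg
    have q := hX.quadrilateral (hX.interp f₁ f₂ t v) (hX.interp f₁ f₂ t w) (f₁ w) (f₁ v)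
    rw [dist_comm (hX.interp f₁ f₂ t v) (f₁ w), dist_comm (hX.interp f₁ f₂ t w) (f₁ v),
      dist_comm (hX.interp f₁ f₂ t w) (f₁ w), dist_comm (hX.interp f₁ f₂ t v) (f₁ v),
      hX.dist_sq_interp_left h₁ hp ht, hX.dist_sq_interp_left h₁ hp ht,
      hX.dist_sq_interp_left h₁ hp ht, hX.dist_sq_interp_left h₁ hp ht, h₁.dist_eq, dist_eq_norm,
      norm_sub_rev w v, sub_self, sub_self, norm_zero] at q
    linarith

/-- The flat strip theorem. -/
theorem IsCAT0.dist_sq_interp (hX : IsCAT0 X) {f₁ f₂ : V → X} (h₁ : Isometry f₁)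
    (h₂ : Isometry f₂) (hp : Parallel f₁ f₂) {s t : ℝ} (hs : s ∈ Set.Icc (0 : ℝ) 1)
    (ht : t ∈ Set.Icc (0 : ℝ) 1) (v w : V) :
    dist (hX.interp f₁ f₂ s v) (hX.interp f₁ f₂ t w) ^ 2 =
      ‖v - w‖ ^ 2 + (s - t) ^ 2 * dist (f₁ 0) (f₂ 0) ^ 2 := by
  refine le_antisymm (hX.dist_sq_interp_le h₁ h₂ hp hs ht v w) ?_
  have a := hX.dist_sq_isometry_le (hX.isometry_interp h₁ h₂ hp hs) (hX.interp f₁ f₂ t w) w (v - w)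
  have b := hX.dist_sq_interp_le h₁ h₂ hp hs ht (w - (v - w)) w
  have c := hX.dist_interp_self h₁ h₂ hp hs ht w
  rw [add_sub_cancel, dist_comm _ (hX.interp f₁ f₂ s w), dist_comm _ (hX.interp f₁ f₂ s v),
    dist_comm _ (hX.interp f₁ f₂ s (w - (v - w))), c] at a
  rw [sub_sub_cancel_left, norm_neg] at b
  linarith

theorem IsCAT0.parallel_interp (hX : IsCAT0 X) {f₁ f₂ : V → X} (h₁ : Isometry f₁)
    (hp : Parallel f₁ f₂) {t : ℝ} (ht : t ∈ Set.Icc (0 : ℝ) 1) :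
    Parallel f₁ (hX.interp f₁ f₂ t) := by
  intro v w
  rw [hX.dist_sq_interp_left h₁ hp ht, hX.dist_sq_interp_left h₁ hp ht]
  simp

end Parallel

/-! ### Invariant flats -/

section InvariantFlat

variable {X : Type v} [MetricSpace X] {V : Type*} [NormedAddCommGroup V] [NormedSpace ℝ V]

/-- The flats parallel to `f₀` satisfy the CN inequality. -/
theorem IsCAT0.exists_midpoint_flat (hX : IsCAT0 X) {f₀ f f' : V → X} (hf₀ : Isometry f₀)
    (hf : Isometry f) (hf' : Isometry f') (p : Parallel f₀ f) (p' : Parallel f₀ f') :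
    ∃ m : V → X, Isometry m ∧ Parallel f₀ m ∧ ∀ z, dist (m 0) z ^ 2 ≤
      dist (f 0) z ^ 2 / 2 + dist (f' 0) z ^ 2 / 2 - dist (f 0) (f' 0) ^ 2 / 4 := by
  have ht : (1 / 2 : ℝ) ∈ Set.Icc (0 : ℝ) 1 := ⟨by norm_num, by norm_num⟩
  have hp := hX.parallel_trans hf hf' p p'
  have hm := hX.isometry_interp hf hf' hp ht
  refine ⟨hX.interp f f' (1 / 2), hm,
    hX.parallel_trans hf₀ hm p.symm (hX.parallel_interp hf hp ht), fun z => ?_⟩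
  have := hX.dist_sq_geo_le (f 0) (f' 0) z ht
  rw [dist_comm, IsCAT0.interp, dist_comm (f 0) z, dist_comm (f' 0) z]
  linarith

/-- A bounded family of flats parallel to `f₀` has a circumcentre. -/
theorem IsCAT0.exists_circumcenter_flat [CompleteSpace X] (hX : IsCAT0 X) {ι : Type*} [Nonempty ι]
    {f₀ : V → X} (hf₀ : Isometry f₀) {F : ι → V → X} {C : ℝ}
    (hC : ∀ i, dist (f₀ 0) (F i 0) ≤ C) :
    ∃ (f : V → X) (R : ℝ), Isometry f ∧ Parallel f₀ f ∧ (∀ i, dist (f 0) (F i 0) ≤ R) ∧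
      ∀ f' : V → X, Isometry f' → Parallel f₀ f' → (∀ i, dist (f' 0) (F i 0) ≤ R) → f' = f := by
  let radii : Set ℝ := {R | ∃ f : V → X, Isometry f ∧ Parallel f₀ f ∧
    ∀ i, dist (f 0) (F i 0) ≤ R}
  have hne : radii.Nonempty := ⟨C, f₀, hf₀, hf₀.parallel_refl, hC⟩
  have hnonneg : ∀ R ∈ radii, 0 ≤ R := by
    rintro R ⟨f, -, -, h⟩
    exact dist_nonneg.trans (h (Classical.arbitrary ι))
  have hbdd : BddBelow radii := ⟨0, fun R hR => hnonneg R hR⟩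
  set R₀ := sInf radii with hR₀
  have hR₀0 : 0 ≤ R₀ := le_csInf hne hnonneg
  -- The midpoint flat has radius at least R₀, so CN forces near-minimisers to be close. This gives
  -- a Cauchy sequence and uniqueness.
  have key : ∀ (f f' : V → X) (R R' : ℝ), Isometry f → Isometry f' → Parallel f₀ f →
      Parallel f₀ f' → (∀ i, dist (f 0) (F i 0) ≤ R) → (∀ i, dist (f' 0) (F i 0) ≤ R') →
      dist (f 0) (f' 0) ^ 2 ≤ 2 * R ^ 2 + 2 * R' ^ 2 - 4 * R₀ ^ 2 := by
    intro f f' R R' hf hf' p p' hR hR'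
    obtain ⟨m, hm, pm, hCN⟩ := hX.exists_midpoint_flat hf₀ hf hf' p p'
    set Q := R ^ 2 / 2 + R' ^ 2 / 2 - dist (f 0) (f' 0) ^ 2 / 4 with hQ
    have hmQ : ∀ i, dist (m 0) (F i 0) ^ 2 ≤ Q := fun i => by
      have h1 := pow_le_pow_left₀ dist_nonneg (hR i) 2
      have h2 := pow_le_pow_left₀ dist_nonneg (hR' i) 2
      have h3 := hCN (F i 0)
      linarith
    have hQ0 : 0 ≤ Q := (sq_nonneg _).trans (hmQ (Classical.arbitrary ι))
    have hle : R₀ ≤ √Q := csInf_le hbdd ⟨m, hm, pm, fun i => Real.le_sqrt_of_sq_le (hmQ i)⟩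
    have := pow_le_pow_left₀ hR₀0 hle 2
    rw [Real.sq_sqrt hQ0] at this
    linarith
  have hex : ∀ n : ℕ, ∃ f : V → X, Isometry f ∧ Parallel f₀ f ∧
      ∀ i, dist (f 0) (F i 0) ≤ R₀ + 1 / (n + 1) := by
    intro n
    obtain ⟨R, ⟨f, hf, pf, hR⟩, hlt⟩ := exists_lt_of_csInf_lt hne
      (lt_add_of_pos_right R₀ (Nat.one_div_pos_of_nat (α := ℝ) (n := n)))
    exact ⟨f, hf, pf, fun i => (hR i).trans hlt.le⟩
  choose f hf pf hR using hex
  have hdist : ∀ m n v, dist (f m v) (f n v) = dist (f m 0) (f n 0) := fun m n v =>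
    (hX.parallel_trans (hf m) (hf n) (pf m) (pf n)).dist_eq v
  have hcauchy0 : CauchySeq fun n => f n 0 := by
    rw [Metric.cauchySeq_iff']
    intro ε hε
    obtain ⟨N, hN⟩ := exists_nat_one_div_lt
      (div_pos (pow_pos hε 2) (by linarith : 0 < 8 * R₀ + 4))
    refine ⟨N, fun n hn => ?_⟩
    have h1 := key _ _ _ _ (hf n) (hf N) (pf n) (pf N) (hR n) (hR N)
    set a : ℝ := 1 / (N + 1) with ha
    have ha0 : 0 < a := Nat.one_div_pos_of_nat
    have ha1 : a ≤ 1 := by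
      rw [ha, div_le_one (by positivity)]
      linarith [(Nat.cast_nonneg N : (0 : ℝ) ≤ N)]
    have hb0 : (0 : ℝ) < 1 / (n + 1) := Nat.one_div_pos_of_nat
    have hba : (1 : ℝ) / (n + 1) ≤ a := Nat.one_div_le_one_div hn
    rw [lt_div_iff₀ (by linarith)] at hN
    have h2 : (R₀ + 1 / ((n : ℝ) + 1)) ^ 2 ≤ (R₀ + a) ^ 2 :=
      pow_le_pow_left₀ (by linarith) (by linarith) 2
    refine lt_of_pow_lt_pow_left₀ 2 hε.le ?_
    nlinarith
  have hcauchy : ∀ v, CauchySeq fun n => f n v := by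
    intro v
    rw [Metric.cauchySeq_iff'] at hcauchy0 ⊢
    intro ε hε
    obtain ⟨N, hN⟩ := hcauchy0 ε hε
    exact ⟨N, fun n hn => by rw [hdist]; exact hN n hn⟩
  choose g hg using fun v => cauchySeq_tendsto_of_complete (hcauchy v)
  have hgiso : Isometry g := Isometry.of_dist_eq fun v w =>
    tendsto_nhds_unique ((hg v).dist (hg w)) (by
      simp only [(hf _).dist_eq]; exact tendsto_const_nhds)
  have hgpar : Parallel f₀ g := fun v w =>
    tendsto_nhds_unique ((tendsto_const_nhds.dist (hg w)).pow 2) (by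
      simp only [(pf _) v w]
      exact tendsto_const_nhds.add ((tendsto_const_nhds.dist (hg 0)).pow 2))
  have hgR : ∀ i, dist (g 0) (F i 0) ≤ R₀ := by
    intro i
    have h1 : Filter.Tendsto (fun n : ℕ => R₀ + 1 / ((n : ℝ) + 1)) Filter.atTop
        (nhds (R₀ + 0)) := tendsto_const_nhds.add tendsto_one_div_add_atTop_nhds_zero_nat
    rw [add_zero] at h1
    exact le_of_tendsto_of_tendsto' ((hg 0).dist tendsto_const_nhds) h1 fun n => hR n i
  refine ⟨g, R₀, hgiso, hgpar, hgR, fun f' hf' pf' hR' => ?_⟩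
  have h1 := key _ _ _ _ hf' hgiso pf' hgpar hR' hgR
  have h2 : dist (f' 0) (g 0) = 0 := by
    refine pow_eq_zero_iff two_ne_zero |>.1 (le_antisymm ?_ (sq_nonneg _))
    linarith
  funext v
  have := (hX.parallel_trans hf' hgiso pf' hgpar).dist_eq v
  rw [h2] at this
  exact dist_eq_zero.1 this

/-- A group of isometries that moves a flat only a bounded amount preserves a parallel flat. -/
theorem IsCAT0.exists_invariant_flat [ProperSpace X] [CompleteSpace V] (hX : IsCAT0 X)
    {Γ : Type u} [Group Γ] [MulAction Γ X] [IsIsometricSMul Γ X] (H : Subgroup Γ) {f₀ : V → X}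
    (hf₀ : Isometry f₀) {C : ℝ} (hC : ∀ h ∈ H, ∀ v, ∃ w, dist (h • f₀ v) (f₀ w) ≤ C) :
    ∃ f : V → X, Isometry f ∧ Parallel f₀ f ∧ ∀ h ∈ H, ∀ v, h • f v ∈ Set.range f := by
  have hsmul : ∀ (g : Γ) {f : V → X}, Isometry f → Isometry fun v => g • f v :=
    fun g f hf => (isometry_smul X g).comp hf
  have hC' : ∀ h ∈ H, ∀ v, ∃ w, dist (f₀ v) (h • f₀ w) ≤ C := by
    intro h hh v
    obtain ⟨w, hw⟩ := hC h⁻¹ (H.inv_mem hh) v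
    refine ⟨w, ?_⟩
    rwa [← dist_smul h, smul_inv_smul] at hw
  have hex : ∀ h : H, ∃ A : V → V, Isometry A ∧ Function.Surjective A ∧
      Parallel f₀ fun v => (h : Γ) • f₀ (A v) := fun h =>
    hX.exists_parallel_reparam hf₀ (hsmul h hf₀) (hC' h h.2) (hC h h.2)
  choose A hA hAs hAp using hex
  have hbd : ∀ h : H, dist (f₀ 0) ((h : Γ) • f₀ (A h 0)) ≤ C := by
    intro h
    obtain ⟨w, hw⟩ := hC' h h.2 0
    obtain ⟨w', rfl⟩ := hAs h w
    exact ((hAp h).dist_le 0 w').trans hw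
  obtain ⟨f, R, hf, pf, hR, huniq⟩ := hX.exists_circumcenter_flat hf₀
    (F := fun (h : H) v => (h : Γ) • f₀ (A h v)) hbd
  refine ⟨f, hf, pf, fun k hk => ?_⟩
  obtain ⟨B, hB, hBs, hBp⟩ := hX.exists_parallel_reparam hf₀ (hsmul k hf)
    (C := C + dist (f₀ 0) (f 0)) (C' := dist (f₀ 0) (f 0) + C)
    (fun v => by
      obtain ⟨w, hw⟩ := hC' k hk v
      refine ⟨w, (dist_triangle _ (k • f₀ w) _).trans (add_le_add hw ?_)⟩
      rw [dist_smul, pf.dist_eq])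
    (fun v => by
      obtain ⟨w, hw⟩ := hC k hk v
      refine ⟨w, (dist_triangle _ (k • f₀ v) _).trans (add_le_add ?_ hw)⟩
      rw [dist_smul, dist_comm, pf.dist_eq])
  have hBiso : Isometry ((fun v => k • f v) ∘ B) := (hsmul k hf).comp hB
  -- Up to reparametrisation k permutes the translates of f₀, so k • f is again a circumcentre and
  -- uniqueness identifies it with f.
  have heq := huniq _ hBiso hBp (fun h => by
    have hpar : Parallel ((fun v => k • f v) ∘ B) fun v => (h : Γ) • f₀ (A h v) :=
      hX.parallel_trans hBiso ((hsmul h hf₀).comp (hA h)) hBp (hAp h)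
    set h' : H := ⟨k, hk⟩⁻¹ * h with hh'
    have hval : (h : Γ) = k * (h' : Γ) := by simp [hh']
    have hpar' := (hX.parallel_trans hf ((hsmul h' hf₀).comp (hA h')) pf (hAp h')).dist_eq (B 0)
    obtain ⟨w, hw⟩ := hAs h (A h' (B 0))
    refine (hpar.dist_le 0 w).trans ?_
    simp only [Function.comp]
    rw [hw, hval, mul_smul, dist_smul]
    exact hpar'.le.trans (hR h'))
  intro v
  obtain ⟨w, rfl⟩ := hBs v
  exact ⟨w, (congrFun heq w).symm⟩

end InvariantFlat

/-! ### Proper cocompact actions on CAT(0) spaces -/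

section Geometry

variable {Γ : Type u} [Group Γ] {X : Type v} [MetricSpace X] [MulAction Γ X]

/-- Near a point k: if one g₀ brings k close to x, any other such g differs from g₀ by an element
moving k by less than r, and there are finitely many of those. -/
theorem IsProperCocompactAction.finite_smul_inter_ball (h : IsProperCocompactAction Γ X)
    {K : Set X} (hK : IsCompact K) (x : X) :
    ∃ ε > 0, {g : Γ | ∃ y ∈ K, dist (g • y) x < ε}.Finite := by
  have := h.isIsometricSMul
  refine hK.induction_on (p := fun K => ∃ ε > 0, {g : Γ | ∃ y ∈ K, dist (g • y) x < ε}.Finite)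
    ?_ ?_ ?_ ?_
  · exact ⟨1, one_pos, by simp⟩
  · intro s t hst ht
    obtain ⟨ε, hε, hfin⟩ := ht
    exact ⟨ε, hε, hfin.subset fun g ⟨y, hy, hd⟩ => ⟨y, hst hy, hd⟩⟩
  · intro s t hs ht
    obtain ⟨ε, hε, hfin⟩ := hs
    obtain ⟨ε', hε', hfin'⟩ := ht
    refine ⟨min ε ε', lt_min hε hε', (hfin.union hfin').subset ?_⟩
    rintro g ⟨y, hy | hy, hd⟩
    · exact Or.inl ⟨y, hy, hd.trans_le (min_le_left _ _)⟩
    · exact Or.inr ⟨y, hy, hd.trans_le (min_le_right _ _)⟩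
  · intro k hk
    obtain ⟨r, hr, hfin⟩ := h.finite_near k
    refine ⟨Metric.ball k (r / 4), mem_nhdsWithin_of_mem_nhds (Metric.ball_mem_nhds _ (by linarith)),
      r / 4, by linarith, ?_⟩
    have hhalf : ∀ g : Γ, (∃ y ∈ Metric.ball k (r / 4), dist (g • y) x < r / 4) →
        dist (g • k) x < r / 2 := by
      rintro g ⟨y, hy, hd⟩
      have h1 := dist_triangle (g • k) (g • y) x
      rw [dist_smul, dist_comm k y] at h1
      rw [Metric.mem_ball] at hy
      linarith
    by_cases hne : ∃ g₀ : Γ, dist (g₀ • k) x < r / 2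
    · obtain ⟨g₀, hg₀⟩ := hne
      refine (hfin.image fun g => g₀ * g).subset ?_
      intro g hg
      refine ⟨g₀⁻¹ * g, ?_, by simp⟩
      have h1 := hhalf g hg
      change dist ((g₀⁻¹ * g) • k) k < r
      rw [← dist_smul g₀, smul_smul, mul_inv_cancel_left]
      have h2 := dist_triangle_right (g • k) (g₀ • k) x
      linarith
    · refine Set.Finite.subset Set.finite_empty ?_
      intro g hg
      exact hne ⟨g, hhalf g hg⟩

theorem IsProperCocompactAction.exists_uniform_compact_ball (h : IsProperCocompactAction Γ X) :
    ∃ ε > 0, ∀ x : X, IsCompact (Metric.closedBall x ε) := by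
  have := h.isIsometricSMul
  obtain ⟨K, hK, hcov⟩ := h.cocompact
  have hcov' : ∀ x : X, ∃ g : Γ, ∃ k ∈ K, g • k = x := fun x => by
    have : x ∈ ⋃ g : Γ, g • K := hcov ▸ Set.mem_univ x
    obtain ⟨g, hg⟩ := Set.mem_iUnion.1 this
    exact ⟨g, hg⟩
  have hloc : ∀ x : X, ∃ ε > 0, IsCompact (Metric.closedBall x ε) := by
    intro x
    obtain ⟨ε, hε, hfin⟩ := h.finite_smul_inter_ball hK x
    refine ⟨ε / 2, by linarith, ?_⟩
    refine (hfin.isCompact_biUnion fun g _ => hK.smul g).of_isClosed_subset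
      Metric.isClosed_closedBall ?_
    intro y hy
    obtain ⟨g, k, hk, rfl⟩ := hcov' y
    refine Set.mem_biUnion (x := g) ⟨k, hk, ?_⟩ (Set.smul_mem_smul_set hk)
    rw [Metric.mem_closedBall] at hy
    linarith
  have hunif : ∃ ε > 0, ∀ x ∈ K, IsCompact (Metric.closedBall x ε) := by
    refine hK.induction_on (p := fun K => ∃ ε > 0, ∀ x ∈ K, IsCompact (Metric.closedBall x ε))
      ?_ ?_ ?_ ?_
    · exact ⟨1, one_pos, by simp⟩
    · intro s t hst ht
      obtain ⟨ε, hε, hc⟩ := ht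
      exact ⟨ε, hε, fun x hx => hc x (hst hx)⟩
    · intro s t hs ht
      obtain ⟨ε, hε, hc⟩ := hs
      obtain ⟨ε', hε', hc'⟩ := ht
      refine ⟨min ε ε', lt_min hε hε', ?_⟩
      rintro x (hx | hx)
      · exact (hc x hx).of_isClosed_subset Metric.isClosed_closedBall
          (Metric.closedBall_subset_closedBall (min_le_left _ _))
      · exact (hc' x hx).of_isClosed_subset Metric.isClosed_closedBall
          (Metric.closedBall_subset_closedBall (min_le_right _ _))
    · intro k hk
      obtain ⟨ε, hε, hc⟩ := hloc k
      refine ⟨Metric.ball k (ε / 2), mem_nhdsWithin_of_mem_nhds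
        (Metric.ball_mem_nhds _ (by linarith)), ε / 2, by linarith, fun x hx => ?_⟩
      refine hc.of_isClosed_subset Metric.isClosed_closedBall
        (Metric.closedBall_subset_closedBall' ?_)
      rw [Metric.mem_ball] at hx
      linarith
  obtain ⟨ε, hε, hc⟩ := hunif
  refine ⟨ε, hε, fun x => ?_⟩
  obtain ⟨g, k, hk, rfl⟩ := hcov' x
  have := (hc k hk).smul g
  rwa [Metric.smul_closedBall] at this

/-- As in Hopf–Rinow, geodesics let the radius of compact balls grow by ε/2 at a time: a finite
ε/2-net of one ball gives compact ε-balls covering the next. -/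
theorem IsProperCocompactAction.properSpace (h : IsProperCocompactAction Γ X) (hX : IsCAT0 X) :
    ProperSpace X := by
  obtain ⟨ε, hε, hc⟩ := h.exists_uniform_compact_ball
  have hstep : ∀ (x : X) (n : ℕ), IsCompact (Metric.closedBall x (n * (ε / 2))) := by
    intro x n
    induction n with
    | zero => simp
    | succ n ih =>
      obtain ⟨t, -, htfin, hcov⟩ := ih.finite_cover_balls (by linarith : 0 < ε / 2)
      refine (htfin.isCompact_biUnion fun y _ => hc y).of_isClosed_subset
        Metric.isClosed_closedBall ?_
      intro z hz
      rw [Metric.mem_closedBall, dist_comm] at hz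
      push_cast at hz
      set R : ℝ := n * (ε / 2) with hR
      have hR0 : 0 ≤ R := by positivity
      obtain ⟨p, hp1, hp2⟩ : ∃ p, dist x p ≤ R ∧ dist p z ≤ ε / 2 := by
        rcases le_or_gt (dist x z) R with hle | hlt
        · exact ⟨z, hle, by rw [dist_self]; linarith⟩
        · have hd : 0 < dist x z := hR0.trans_lt hlt
          have hmem : R / dist x z ∈ Set.Icc (0 : ℝ) 1 :=
            ⟨div_nonneg hR0 hd.le, (div_le_one hd).2 hlt.le⟩
          have e : R / dist x z * dist x z = R := div_mul_cancel₀ _ hd.ne'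
          refine ⟨hX.geo x z (R / dist x z), ?_, ?_⟩
          · rw [hX.dist_left_geo _ _ hmem, e]
          · rw [hX.dist_geo_right _ _ hmem, sub_mul, e]; linarith
      obtain ⟨y, hy, hpy⟩ := Set.mem_iUnion₂.1 (hcov (by rwa [Metric.mem_closedBall, dist_comm] :
        p ∈ Metric.closedBall x R))
      refine Set.mem_biUnion hy ?_
      rw [Metric.mem_ball] at hpy
      rw [Metric.mem_closedBall]
      have := dist_triangle_left z y p
      linarith
  refine ⟨fun x r => ?_⟩
  obtain ⟨n, hn⟩ := exists_nat_ge (r / (ε / 2))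
  rw [div_le_iff₀ (by linarith)] at hn
  exact (hstep x n).of_isClosed_subset Metric.isClosed_closedBall
    (Metric.closedBall_subset_closedBall hn)

theorem IsProperCocompactAction.finite_smul_inter (h : IsProperCocompactAction Γ X)
    {K L : Set X} (hK : IsCompact K) (hL : IsCompact L) :
    {g : Γ | ∃ y ∈ K, g • y ∈ L}.Finite := by
  refine hL.induction_on (p := fun L => {g : Γ | ∃ y ∈ K, g • y ∈ L}.Finite) ?_ ?_ ?_ ?_
  · simp
  · intro s t hst ht
    exact ht.subset fun g ⟨y, hy, hd⟩ => ⟨y, hy, hst hd⟩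
  · intro s t hs ht
    refine (hs.union ht).subset ?_
    rintro g ⟨y, hy, hd | hd⟩
    · exact Or.inl ⟨y, hy, hd⟩
    · exact Or.inr ⟨y, hy, hd⟩
  · intro x hx
    obtain ⟨ε, hε, hfin⟩ := h.finite_smul_inter_ball hK x
    exact ⟨Metric.ball x ε, mem_nhdsWithin_of_mem_nhds (Metric.ball_mem_nhds _ hε), hfin⟩

/-- The orbits of an element of infinite order are unbounded. -/
theorem IsProperCocompactAction.exists_pow_far [ProperSpace X] (h : IsProperCocompactAction Γ X)
    (tf : ∀ g : Γ, g ≠ 1 → ¬ IsOfFinOrder g) {a : Γ} (ha : a ≠ 1) (x y : X) (M : ℝ) :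
    ∃ n : ℕ, M < dist (a ^ n • x) y := by
  by_contra! hle
  refine tf a ha (finite_powers.1 ((h.finite_smul_inter (isCompact_singleton (x := x))
    (isCompact_closedBall y M)).subset ?_))
  rintro _ ⟨n, rfl⟩
  exact ⟨x, rfl, hle n⟩

/-- The displacement function of every element attains its minimum. -/
theorem IsProperCocompactAction.exists_min_displacement [ProperSpace X]
    (h : IsProperCocompactAction Γ X) (hne : Nonempty X) (a : Γ) :
    ∃ x : X, ∀ y : X, dist x (a • x) ≤ dist y (a • y) := by
  have := h.isIsometricSMul
  obtain ⟨K, hK, hcov⟩ := h.cocompact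
  have hcov' : ∀ x : X, ∃ g : Γ, ∃ k ∈ K, g • k = x := fun x => by
    have : x ∈ ⋃ g : Γ, g • K := hcov ▸ Set.mem_univ x
    obtain ⟨g, hg⟩ := Set.mem_iUnion.1 this
    exact ⟨g, hg⟩
  obtain ⟨x₀⟩ := hne
  set M := dist x₀ (a • x₀) with hM
  have hconj : ∀ (g : Γ) (k : X), dist (g • k) (a • g • k) = dist k ((g⁻¹ * a * g) • k) := by
    intro g k
    rw [← dist_smul g k, smul_smul, smul_smul]
    congr 2
    group
  -- Moving points into K replaces a by conjugates; only finitely many displace a point of K by at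
  -- most M, so a minimum over K and then over S suffices.
  set S : Set Γ := {s | (∃ g : Γ, s = g⁻¹ * a * g) ∧ ∃ k ∈ K, dist k (s • k) ≤ M} with hS
  have hSfin : S.Finite := by
    refine (h.finite_smul_inter hK (hK.cthickening (r := M))).subset ?_
    rintro s ⟨-, k, hk, hd⟩
    refine ⟨k, hk, Metric.mem_cthickening_of_dist_le _ k M K hk ?_⟩
    rwa [dist_comm]
  obtain ⟨g₀, k₀, hk₀, hgk₀⟩ := hcov' x₀
  have hKne : K.Nonempty := ⟨k₀, hk₀⟩
  have hmin : ∀ s : Γ, ∃ k ∈ K, ∀ k' ∈ K, dist k (s • k) ≤ dist k' (s • k') := by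
    intro s
    obtain ⟨k, hk, hkm⟩ := hK.exists_isMinOn hKne
      (continuous_id.dist (isometry_smul X s).continuous).continuousOn
    exact ⟨k, hk, fun k' hk' => hkm hk'⟩
  choose m hmK hm using hmin
  have hS₀ : g₀⁻¹ * a * g₀ ∈ S := ⟨⟨g₀, rfl⟩, k₀, hk₀, by rw [← hconj, hgk₀]⟩
  obtain ⟨s, hsS, hs⟩ := Set.exists_min_image S (fun s => dist (m s) (s • m s)) hSfin ⟨_, hS₀⟩
  obtain ⟨⟨g, rfl⟩, -⟩ := id hsS
  refine ⟨g • m (g⁻¹ * a * g), fun y => ?_⟩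
  rw [hconj]
  obtain ⟨g', k', hk', rfl⟩ := hcov' y
  by_cases hle : dist (g' • k') (a • g' • k') ≤ M
  · rw [hconj] at hle ⊢
    exact (hs _ ⟨⟨g', rfl⟩, k', hk', hle⟩).trans (hm _ k' hk')
  · refine le_trans ?_ (not_le.1 hle).le
    refine (hs _ hS₀).trans ((hm _ k₀ hk₀).trans ?_)
    rw [← hconj, hgk₀]

/-! ### Axes -/

theorem IsCAT0.smul_geo [IsIsometricSMul Γ X] (hX : IsCAT0 X) (g : Γ) (x y : X) {t : ℝ}
    (ht : t ∈ Set.Icc (0 : ℝ) 1) : g • hX.geo x y t = hX.geo (g • x) (g • y) t := by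
  refine hX.eq_geo ht ?_ ?_
  · rw [dist_smul, dist_smul, hX.dist_left_geo _ _ ht]
  · rw [dist_smul, dist_smul, hX.dist_geo_right _ _ ht]

theorem IsCAT0.dist_geo_geo_same_le (hX : IsCAT0 X) (x y : X) {s t : ℝ}
    (hs : s ∈ Set.Icc (0 : ℝ) 1) (ht : t ∈ Set.Icc (0 : ℝ) 1) :
    dist (hX.geo x y s) (hX.geo x y t) ≤ |s - t| * dist x y := by
  refine le_of_sq_le_sq ?_ (by positivity)
  have := hX.dist_sq_geo_le x y (hX.geo x y s) ht
  rw [dist_comm _ x, hX.dist_left_geo _ _ hs, hX.dist_geo_right _ _ hs] at this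
  refine this.trans (le_of_eq ?_)
  rw [mul_pow |s - t|, sq_abs]; ring

/-- The midpoint of y and b y and its image under b are midpoints of two sides of the triangle y, b
y, b² y. -/
theorem IsCAT0.two_mul_le_displacement_sq [IsIsometricSMul Γ X] (hX : IsCAT0 X) {b : Γ} {c : ℝ}
    (hc : ∀ y : X, c ≤ dist y (b • y)) (y : X) : 2 * c ≤ dist y ((b * b) • y) := by
  have ht : (1 / 2 : ℝ) ∈ Set.Icc (0 : ℝ) 1 := ⟨by norm_num, by norm_num⟩
  have h1 := hX.dist_geo_geo_le_of_left (b • y) y ((b * b) • y) ht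
  have h2 := hc (hX.geo y (b • y) (1 / 2))
  have h3 : hX.geo (b • y) y (1 / 2) = hX.geo y (b • y) (1 / 2) := by
    have := hX.geo_symm y (b • y) ht
    rwa [show (1 : ℝ) - 1 / 2 = 1 / 2 by norm_num] at this
  rw [hX.smul_geo b _ _ ht, smul_smul] at h2
  rw [h3] at h1
  linarith

/-- The previous lemma settles exponents that are powers of 2; a general n is completed to 2^n = n +
k, where slack in the triangle inequality is impossible. -/
theorem IsCAT0.dist_pow_smul [IsIsometricSMul Γ X] (hX : IsCAT0 X) {a : Γ} {x : X}
    (hmin : ∀ y : X, dist x (a • x) ≤ dist y (a • y)) (n : ℕ) :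
    dist x (a ^ n • x) = n * dist x (a • x) := by
  set τ := dist x (a • x) with hτ
  have hle : ∀ n : ℕ, dist x (a ^ n • x) ≤ n * τ := by
    intro n
    induction n with
    | zero => simp
    | succ n ih =>
      have := dist_triangle x (a ^ n • x) (a ^ (n + 1) • x)
      rw [pow_succ, mul_smul, dist_smul, ← hτ, ← mul_smul, ← pow_succ] at this
      push_cast
      linarith
  have hpow : ∀ (m : ℕ) (y : X), 2 ^ m * τ ≤ dist y (a ^ (2 ^ m) • y) := by
    intro m
    induction m with
    | zero => intro y; simpa using hmin y
    | succ m ih =>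
      intro y
      have := hX.two_mul_le_displacement_sq ih y
      rw [← pow_two (a ^ 2 ^ m), ← pow_mul, ← pow_succ] at this
      refine le_trans (le_of_eq ?_) this
      ring
  refine le_antisymm (hle n) ?_
  obtain ⟨k, hk⟩ : ∃ k, n + k = 2 ^ n := ⟨2 ^ n - n, by have := Nat.lt_two_pow_self (n := n); omega⟩
  have h1 := hpow n x
  have h2 := dist_triangle x (a ^ n • x) (a ^ (2 ^ n) • x)
  rw [← hk, pow_add, mul_smul, dist_smul] at h2
  rw [← hk, pow_add, mul_smul] at h1
  have h3 := hle k
  have h4 : (2 : ℝ) ^ n = n + k := by exact_mod_cast hk.symm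
  rw [h4] at h1
  linarith

theorem IsCAT0.dist_zpow_smul [IsIsometricSMul Γ X] (hX : IsCAT0 X) {a : Γ} {x : X}
    (hmin : ∀ y : X, dist x (a • x) ≤ dist y (a • y)) {i j : ℤ} (hij : i ≤ j) :
    dist (a ^ i • x) (a ^ j • x) = (j - i) * dist x (a • x) := by
  obtain ⟨n, rfl⟩ := Int.le.dest hij
  rw [zpow_add, mul_smul, dist_smul, zpow_natCast, hX.dist_pow_smul hmin]
  push_cast
  ring

/-- An isometry whose displacement attains its positive minimum translates a geodesic line. -/
theorem IsCAT0.exists_axis [IsIsometricSMul Γ X] (hX : IsCAT0 X) {a : Γ} {x : X}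
    (hmin : ∀ y : X, dist x (a • x) ≤ dist y (a • y)) (hpos : 0 < dist x (a • x)) :
    ∃ f : ℝ → X, Isometry f ∧ ∀ s, a • f s = f (s + dist x (a • x)) := by
  set τ := dist x (a • x) with hτ
  let L : ℝ → X := fun s => a ^ ⌊s⌋ • hX.geo x (a • x) (Int.fract s)
  have hfr : ∀ s : ℝ, Int.fract s ∈ Set.Icc (0 : ℝ) 1 := fun s =>
    ⟨Int.fract_nonneg s, (Int.fract_lt_one s).le⟩
  have hleft : ∀ s, dist (a ^ ⌊s⌋ • x) (L s) = Int.fract s * τ := fun s => by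
    rw [dist_smul, hX.dist_left_geo _ _ (hfr s)]
  have hright : ∀ s, dist (L s) (a ^ (⌊s⌋ + 1) • x) = (1 - Int.fract s) * τ := fun s => by
    rw [zpow_add_one, mul_smul, dist_smul, hX.dist_geo_right _ _ (hfr s)]
  have hdist : ∀ s t, s ≤ t → dist (L s) (L t) = (t - s) * τ := by
    intro s t hst
    have hfl : ⌊s⌋ ≤ ⌊t⌋ := Int.floor_le_floor hst
    have es : (⌊s⌋ : ℝ) + Int.fract s = s := Int.floor_add_fract s
    have et : (⌊t⌋ : ℝ) + Int.fract t = t := Int.floor_add_fract t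
    refine le_antisymm ?_ ?_
    · rcases hfl.eq_or_lt with heq | hlt
      · have h1 := hX.dist_geo_geo_same_le x (a • x) (hfr s) (hfr t)
        have h2 : dist (L s) (L t) =
            dist (hX.geo x (a • x) (Int.fract s)) (hX.geo x (a • x) (Int.fract t)) := by
          simp only [L]
          rw [heq, dist_smul]
        rw [h2]
        refine h1.trans (le_of_eq ?_)
        have h3 : (⌊s⌋ : ℝ) = ⌊t⌋ := by rw [heq]
        rw [show Int.fract s - Int.fract t = s - t by linarith, abs_sub_comm,
          abs_of_nonneg (by linarith)]
      · have h1 := dist_triangle4 (L s) (a ^ (⌊s⌋ + 1) • x) (a ^ ⌊t⌋ • x) (L t)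
        rw [hright, hleft, hX.dist_zpow_smul hmin hlt, ← hτ] at h1
        refine h1.trans (le_of_eq ?_)
        push_cast
        linear_combination τ * (et - es)
    -- By `dist_zpow_smul` the path between these two orbit points has the length of their distance,
    -- so no subpath can be shortened.
    · have h1 := dist_triangle4 (a ^ ⌊s⌋ • x) (L s) (L t) (a ^ (⌊t⌋ + 1) • x)
      rw [hright, hleft, hX.dist_zpow_smul hmin (by omega), ← hτ] at h1
      push_cast at h1
      have : (t - s) * τ = ((⌊t⌋ : ℝ) + 1 - ⌊s⌋) * τ - Int.fract s * τ -
          (1 - Int.fract t) * τ := by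
        linear_combination τ * (es - et)
      linarith
  refine ⟨fun s => L (s / τ), ?_, ?_⟩
  · refine Isometry.of_dist_eq fun s t => ?_
    wlog hst : s ≤ t generalizing s t
    · rw [dist_comm, this t s (le_of_not_ge hst), dist_comm]
    rw [hdist _ _ (by gcongr), ← sub_div, div_mul_cancel₀ _ hpos.ne', dist_comm, Real.dist_eq,
      abs_of_nonneg (by linarith)]
  · intro s
    simp only [L]
    rw [add_div, div_self hpos.ne', Int.floor_add_one, Int.fract_add_one, add_comm ⌊s / τ⌋ 1,
      zpow_add, zpow_one, mul_smul]

end Geometry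

/-! ### Isolated flats -/

section Isolated

variable {X : Type v} [MetricSpace X]

/-- The points at distance at most `k` from some point of `E`. -/
def nearSet (k : ℝ) (E : Set X) : Set X := {x | ∃ y ∈ E, dist x y ≤ k}

theorem nearSet_mono {k k' : ℝ} (h : k ≤ k') (E : Set X) : nearSet k E ⊆ nearSet k' E :=
  fun _ ⟨y, hy, hd⟩ => ⟨y, hy, hd.trans h⟩

theorem mem_nearSet_of_dist_le {k c : ℝ} {E : Set X} {x y : X} (hy : y ∈ nearSet k E)
    (h : dist x y ≤ c) : x ∈ nearSet (c + k) E := by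
  obtain ⟨z, hz, hd⟩ := hy
  exact ⟨z, hz, (dist_triangle _ _ _).trans (add_le_add h hd)⟩

/-- A family of flats witnessing the isolated flats condition. -/
structure IsolatedFamily (F : Set (Set X)) (B : ℝ) (φ : ℝ → ℝ) : Prop where
  isFlat : ∀ E ∈ F, IsFlat E
  nonneg : 0 ≤ B
  near : ∀ E, IsFlat E → ∃ E' ∈ F, E ⊆ nearSet B E'
  eq_of_le : ∀ E ∈ F, ∀ E' ∈ F, ∀ (k : ℝ) (x y : X), x ∈ nearSet k E → x ∈ nearSet k E' →
    y ∈ nearSet k E → y ∈ nearSet k E' → φ k ≤ dist x y → E = E'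

theorem IsFlat.nonempty {E : Set X} (hE : IsFlat E) : E.Nonempty := by
  obtain ⟨k, -, f, -, rfl⟩ := hE
  exact ⟨f 0, 0, rfl⟩

/-- The constant grows to B + 1 because `cthickening` uses an infimum that need not be attained. -/
theorem HasIsolatedFlats.exists_family (h : HasIsolatedFlats X) :
    ∃ (F : Set (Set X)) (B : ℝ) (φ : ℝ → ℝ), IsolatedFamily F B φ := by
  obtain ⟨F, hF, ⟨B, hB⟩, φ, hφ⟩ := h
  refine ⟨F, B + 1, fun k => φ k.toNNReal, hF, by positivity, ?_, ?_⟩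
  · intro E hE
    obtain ⟨E', hE', hsub⟩ := hB E hE
    refine ⟨E', hE', fun x hx => ?_⟩
    have h1 := hsub hx
    rw [Metric.mem_cthickening_iff] at h1
    have h2 : Metric.infEDist x E' < ENNReal.ofReal ((B : ℝ) + 1) :=
      h1.trans_lt ((ENNReal.ofReal_lt_ofReal_iff (by positivity)).2 (by linarith))
    obtain ⟨y, hy, hlt⟩ := Metric.infEDist_lt_iff.1 h2
    refine ⟨y, hy, ?_⟩
    rw [edist_dist, ENNReal.ofReal_lt_ofReal_iff (by positivity)] at hlt
    exact hlt.le
  · intro E hE E' hE' k x y hx hx' hy hy' hle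
    by_contra hne
    have h1 := hφ E hE E' hE' hne k.toNNReal
    have hsub : ∀ E : Set X, nearSet k E ⊆ Metric.cthickening (k.toNNReal : ℝ) E := by
      rintro E z ⟨w, hw, hd⟩
      refine Metric.mem_cthickening_of_dist_le _ w _ _ hw (hd.trans ?_)
      exact Real.le_coe_toNNReal k
    have h2 := (Metric.edist_le_ediam_of_mem (Set.mem_inter (hsub _ hx) (hsub _ hx'))
      (Set.mem_inter (hsub _ hy) (hsub _ hy'))).trans_lt h1
    rw [edist_nndist, ENNReal.coe_lt_coe, ← NNReal.coe_lt_coe, coe_nndist] at h2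
    linarith

theorem EuclideanSpace.exists_norm_eq {k : ℕ} (hk : 0 < k) {M : ℝ} (hM : 0 ≤ M) :
    ∃ v : EuclideanSpace ℝ (Fin k), ‖v‖ = M :=
  ⟨EuclideanSpace.single ⟨0, hk⟩ M, by simp [hM]⟩

theorem IsFlat.exists_far {E : Set X} (hE : IsFlat E) (M : ℝ) :
    ∃ x ∈ E, ∃ y ∈ E, M ≤ dist x y := by
  obtain ⟨k, hk, f, hf, rfl⟩ := hE
  obtain ⟨v, hv⟩ := EuclideanSpace.exists_norm_eq (k := k) (by omega) (abs_nonneg M)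
  refine ⟨f v, ⟨v, rfl⟩, f 0, ⟨0, rfl⟩, ?_⟩
  rw [hf.dist_eq, dist_zero_right, hv]
  exact le_abs_self M

variable {F : Set (Set X)} {B : ℝ} {φ : ℝ → ℝ}

/-- A member of the family that is coarsely contained, along an unbounded set, in another
member, equals it. -/
theorem IsolatedFamily.eq_of_unbounded (hF : IsolatedFamily F B φ) {E E' : Set X} (hE : E ∈ F)
    (hE' : E' ∈ F) {k : ℝ}
    (h : ∀ M, ∃ x y, x ∈ nearSet k E ∧ x ∈ nearSet k E' ∧ y ∈ nearSet k E ∧ y ∈ nearSet k E' ∧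
      M ≤ dist x y) : E = E' := by
  obtain ⟨x, y, h1, h2, h3, h4, h5⟩ := h (φ k)
  exact hF.eq_of_le E hE E' hE' k x y h1 h2 h3 h4 h5

variable {Γ : Type u} [Group Γ] [MulAction Γ X]

theorem IsFlat.smul [IsIsometricSMul Γ X] {E : Set X} (hE : IsFlat E) (g : Γ) :
    IsFlat (g • E) := by
  obtain ⟨k, hk, f, hf, rfl⟩ := hE
  exact ⟨k, hk, fun v => g • f v, (isometry_smul X g).comp hf, by
    rw [← Set.image_smul, ← Set.range_comp]; rfl⟩

/-! ### Large flat discs -/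

/-- Large flat discs are close to flat planes near their centres. -/
theorem IsProperCocompactAction.exists_plane_near_disc [ProperSpace X]
    (h : IsProperCocompactAction Γ X) (r : ℝ) :
    ∃ R > 0, ∀ ψ : EPlane → X,
      (∀ x y, ‖x‖ ≤ R → ‖y‖ ≤ R → dist (ψ x) (ψ y) = dist x y) →
      ∃ θ : EPlane → X, Isometry θ ∧ ∀ x, ‖x‖ ≤ r → dist (ψ x) (θ x) ≤ 1 := by
  have := h.isIsometricSMul
  by_contra! hbad
  choose ψ hψ hψbad using fun n : ℕ => hbad (n + 1) (by positivity)
  obtain ⟨K, hK, hcov⟩ := h.cocompact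
  have hcov' : ∀ x : X, ∃ g : Γ, g • x ∈ K := fun x => by
    have : x ∈ ⋃ g : Γ, g • K := hcov ▸ Set.mem_univ x
    obtain ⟨g, k, hk, rfl⟩ := Set.mem_iUnion.1 this
    exact ⟨g⁻¹, by simpa using hk⟩
  choose g hg using fun n => hcov' (ψ n 0)
  -- The bad discs, with centres moved into K, converge pointwise along an ultrafilter to an
  -- isometric plane; a finite 1/3-net then makes the approximation uniform on the r-ball.
  let U : Ultrafilter ℕ := Ultrafilter.of Filter.atTop
  have hU : (U : Filter ℕ) ≤ Filter.atTop := Ultrafilter.of_le _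
  have hev : ∀ r : ℝ, ∀ᶠ n : ℕ in (U : Filter ℕ), r ≤ (n : ℝ) + 1 := fun r =>
    hU ((Filter.eventually_ge_atTop ⌈r⌉₊).mono fun n hn => by
      have h1 := Nat.le_ceil r
      have h2 : (⌈r⌉₊ : ℝ) ≤ n := by exact_mod_cast hn
      linarith)
  have hlim : ∀ x : EPlane, ∃ y : X,
      Filter.Tendsto (fun n => g n • ψ n x) (U : Filter ℕ) (nhds y) := by
    intro x
    have hmem : ∀ᶠ n in (U : Filter ℕ), g n • ψ n x ∈ Metric.cthickening ‖x‖ K := by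
      filter_upwards [hev ‖x‖] with n hn
      refine Metric.mem_cthickening_of_dist_le _ _ _ _ (hg n) ?_
      rw [dist_smul, hψ n x 0 hn (by rw [norm_zero]; positivity), dist_zero_right]
    obtain ⟨y, -, hy⟩ := (hK.cthickening (r := ‖x‖)).ultrafilter_le_nhds
      (U.map fun n => g n • ψ n x) (Filter.le_principal_iff.2 hmem)
    exact ⟨y, hy⟩
  choose θ hθ using hlim
  have hθiso : Isometry θ := by
    refine Isometry.of_dist_eq fun x y => ?_
    refine tendsto_nhds_unique ((hθ x).dist (hθ y)) ?_
    refine tendsto_const_nhds.congr' ?_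
    filter_upwards [hev ‖x‖, hev ‖y‖] with n hx hy
    rw [dist_smul, hψ n x y hx hy]
  obtain ⟨t, -, htfin, htcov⟩ := (isCompact_closedBall (0 : EPlane) r).finite_cover_balls
    (by norm_num : (0 : ℝ) < 1 / 3)
  have hnet : ∀ᶠ n in (U : Filter ℕ), ∀ x ∈ t, dist (g n • ψ n x) (θ x) < 1 / 3 :=
    (Filter.eventually_all_finite htfin).2 fun x _ =>
      (hθ x).eventually (Metric.ball_mem_nhds _ (by norm_num))
  have hnorm : ∀ᶠ n : ℕ in (U : Filter ℕ), ∀ x ∈ t, ‖x‖ ≤ (n : ℝ) + 1 :=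
    (Filter.eventually_all_finite htfin).2 fun x _ => hev ‖x‖
  obtain ⟨n, hn1, hn2, hn3⟩ := (hnet.and (hnorm.and (hev r))).exists
  obtain ⟨x, hx, hlt⟩ := hψbad n (fun x => (g n)⁻¹ • θ x) ((isometry_smul X _).comp hθiso)
  obtain ⟨c, hc, hxc⟩ := Set.mem_iUnion₂.1 (htcov (by simpa using hx : x ∈ Metric.closedBall 0 r))
  rw [Metric.mem_ball] at hxc
  have h1 : dist (ψ n x) ((g n)⁻¹ • θ x) = dist (g n • ψ n x) (θ x) := by
    rw [← dist_smul (g n), smul_inv_smul]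
  have h2 := dist_triangle4 (g n • ψ n x) (g n • ψ n c) (θ c) (θ x)
  rw [dist_smul, hψ n x c (hx.trans hn3) (hn2 c hc), hθiso.dist_eq, dist_comm c x] at h2
  have h3 := hn1 c hc
  linarith

/-- A line that bounds a wide flat strip lies near a member of the family. -/
theorem IsProperCocompactAction.exists_flat_near_wide_strip [ProperSpace X]
    (h : IsProperCocompactAction Γ X) (hX : IsCAT0 X) (hF : IsolatedFamily F B φ) :
    ∃ R : ℝ, ∀ f f' : ℝ → X, Isometry f → Isometry f' → Parallel f f' →
      R ≤ dist (f 0) (f' 0) → ∃ E ∈ F, ∃ C, ∀ s, f s ∈ nearSet C E := by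
  -- In k, 1 is the error of the plane and B its distance to the family. The length r makes windows
  -- with centres at most 1 apart overlap in length at least φ k, so they select the same member.
  set k : ℝ := 1 + B with hk
  set r : ℝ := |φ k| + 1 with hr
  have hr1 : 1 ≤ r := by linarith [abs_nonneg (φ k)]
  obtain ⟨R, hR, hdisc⟩ := h.exists_plane_near_disc r
  refine ⟨2 * R, fun f f' hf hf' hp hD => ?_⟩
  set D := dist (f 0) (f' 0) with hDdef
  have hD0 : 0 < D := by linarith
  have hhalf : (1 / 2 : ℝ) ∈ Set.Icc (0 : ℝ) 1 := ⟨by norm_num, by norm_num⟩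
  set μ : ℝ → X := hX.interp f f' (1 / 2) with hμ
  have hμiso : Isometry μ := hX.isometry_interp hf hf' hp hhalf
  have hcoord : ∀ x : EPlane, ‖x‖ ^ 2 = x 0 ^ 2 + x 1 ^ 2 := fun x => by
    rw [EuclideanSpace.norm_sq_eq, Fin.sum_univ_two, Real.norm_eq_abs, Real.norm_eq_abs, sq_abs,
      sq_abs]
  have hlocal : ∀ s : ℝ, ∃ E ∈ F, ∀ t, |t| ≤ r → μ (s + t) ∈ nearSet k E := by
    intro s
    have hmem : ∀ x : EPlane, ‖x‖ ≤ R → 1 / 2 + x 1 / D ∈ Set.Icc (0 : ℝ) 1 := by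
      intro x hx
      have h1 : |x 1| ≤ D / 2 := by
        have h2 : |x 1| ≤ R := by
          refine abs_le_of_sq_le_sq ?_ hR.le
          have := pow_le_pow_left₀ (norm_nonneg x) hx 2
          rw [hcoord] at this
          nlinarith [sq_nonneg (x 0)]
        linarith
      have h3 : |x 1 / D| ≤ 1 / 2 := by
        rw [abs_div, abs_of_pos hD0, div_le_iff₀ hD0]; linarith
      rw [abs_le] at h3
      exact ⟨by linarith [h3.1], by linarith [h3.2]⟩
    obtain ⟨θ, hθ, hθnear⟩ := hdisc (fun x => hX.interp f f' (1 / 2 + x 1 / D) (s + x 0)) (by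
      intro x y hx hy
      refine (pow_left_inj₀ dist_nonneg dist_nonneg two_ne_zero).1 ?_
      rw [hX.dist_sq_interp hf hf' hp (hmem x hx) (hmem y hy), dist_eq_norm, hcoord,
        add_sub_add_left_eq_sub, add_sub_add_left_eq_sub, Real.norm_eq_abs, sq_abs, ← hDdef]
      simp only [PiLp.sub_apply]
      field_simp)
    obtain ⟨E, hE, hsub⟩ := hF.near (Set.range θ) ⟨2, le_rfl, θ, hθ, rfl⟩
    refine ⟨E, hE, fun t ht => ?_⟩
    have hx : ‖(!₂[t, 0] : EPlane)‖ ≤ r := by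
      refine abs_le_of_sq_le_sq' ?_ (by linarith) |>.2
      rw [hcoord]
      have := pow_le_pow_left₀ (abs_nonneg t) ht 2
      rw [sq_abs] at this
      simpa using this
    have h1 := hθnear _ hx
    simp only [Matrix.cons_val_zero, Matrix.cons_val_one, zero_div, add_zero]
      at h1
    exact mem_nearSet_of_dist_le (hsub ⟨_, rfl⟩) h1
  choose E hE hnear using hlocal
  have hstep : ∀ s s', s ≤ s' → s' ≤ s + 1 → E s = E s' := by
    intro s s' h1 h2
    have e1 : μ s' = μ (s + (s' - s)) := by rw [add_sub_cancel]
    have e2 : μ (s' + (r - 1)) = μ (s + (s' - s + (r - 1))) := by congr 1; ring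
    refine hF.eq_of_le _ (hE s) _ (hE s') k (μ s') (μ (s' + (r - 1))) ?_ ?_ ?_ ?_ ?_
    · rw [e1]
      exact hnear s _ (by rw [abs_of_nonneg (by linarith)]; linarith)
    · have := hnear s' 0 (by rw [abs_zero]; linarith)
      rwa [add_zero] at this
    · rw [e2]
      exact hnear s _ (by rw [abs_of_nonneg (by linarith)]; linarith)
    · exact hnear s' _ (by rw [abs_of_nonneg (by linarith)]; linarith)
    · rw [hμiso.dist_eq, Real.dist_eq, sub_add_cancel_left, abs_neg, abs_of_nonneg (by linarith)]
      linarith [le_abs_self (φ k)]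
  have hint : ∀ n : ℤ, E n = E (0 : ℤ) := by
    intro n
    induction n using Int.induction_on with
    | zero => rfl
    | succ i ih =>
      rw [← ih]
      push_cast
      exact (hstep _ _ (by linarith) le_rfl).symm
    | pred i ih =>
      rw [← ih]
      push_cast
      exact hstep _ _ (by linarith) (by linarith)
  refine ⟨E (0 : ℤ), hE _, D / 2 + k, fun s => ?_⟩
  have h1 : E s = E (0 : ℤ) := by
    rw [← hint ⌊s⌋]
    exact (hstep _ _ (Int.floor_le s) (Int.lt_floor_add_one s).le).symm
  have h2 := hnear s 0 (by rw [abs_zero]; linarith)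
  rw [add_zero, h1] at h2
  refine mem_nearSet_of_dist_le h2 ?_
  have h3 := hX.dist_left_geo (f s) (f' s) hhalf
  change dist (f s) (μ s) = _ at h3
  rw [h3, hp.dist_eq]
  linarith

end Isolated

/-! ### Peripheral subgroups -/

section Peripheral

variable {X : Type v} [MetricSpace X] {F : Set (Set X)} {B : ℝ} {φ : ℝ → ℝ}
  {Γ : Type u} [Group Γ] [MulAction Γ X] [IsIsometricSMul Γ X]

/-- If `g` maps an unbounded part of a member `E` of the family near `E`, then it maps `E` into
the `B`-neighbourhood of `E`. -/
theorem IsolatedFamily.smul_mem_nearSet (hF : IsolatedFamily F B φ) {E : Set X} (hE : E ∈ F)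
    {g : Γ} {k : ℝ}
    (h : ∀ M, ∃ x ∈ E, ∃ y ∈ E, g • x ∈ nearSet k E ∧ g • y ∈ nearSet k E ∧ M ≤ dist x y) :
    ∀ x ∈ E, g • x ∈ nearSet B E := by
  obtain ⟨E', hE', hsub⟩ := hF.near _ ((hF.isFlat E hE).smul g)
  have heq : E = E' := by
    refine hF.eq_of_unbounded hE hE' (k := max k B) fun M => ?_
    obtain ⟨x, hx, y, hy, hgx, hgy, hM⟩ := h M
    exact ⟨g • x, g • y, nearSet_mono (le_max_left _ _) _ hgx,
      nearSet_mono (le_max_right _ _) _ (hsub (Set.smul_mem_smul_set hx)),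
      nearSet_mono (le_max_left _ _) _ hgy,
      nearSet_mono (le_max_right _ _) _ (hsub (Set.smul_mem_smul_set hy)), by rwa [dist_smul]⟩
  intro x hx
  rw [heq]
  exact hsub (Set.smul_mem_smul_set hx)

/-- The coarse stabiliser of a member of the family. -/
def IsolatedFamily.peripheral (hF : IsolatedFamily F B φ) {E : Set X} (hE : E ∈ F) :
    Subgroup Γ where
  carrier := {g | (∀ x ∈ E, g • x ∈ nearSet B E) ∧ ∀ x ∈ E, g⁻¹ • x ∈ nearSet B E}
  one_mem' := by
    have : ∀ x ∈ E, x ∈ nearSet B E := fun x hx => ⟨x, hx, by rw [dist_self]; exact hF.nonneg⟩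
    simpa using this
  inv_mem' := fun {g} hg => ⟨hg.2, by simpa using hg.1⟩
  mul_mem' := by
    have key : ∀ g h : Γ, (∀ x ∈ E, g • x ∈ nearSet B E) → (∀ x ∈ E, h • x ∈ nearSet B E) →
        ∀ x ∈ E, (g * h) • x ∈ nearSet B E := by
      intro g h hg hh
      -- Composition doubles the constant; isolation restores B.
      have hnear : ∀ x ∈ E, (g * h) • x ∈ nearSet (B + B) E := by
        intro x hx
        obtain ⟨y, hy, hd⟩ := hh x hx
        refine mem_nearSet_of_dist_le (hg y hy) ?_
        rwa [mul_smul, dist_smul]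
      refine hF.smul_mem_nearSet hE (k := B + B) fun M => ?_
      obtain ⟨x, hx, y, hy, hM⟩ := (hF.isFlat E hE).exists_far M
      exact ⟨x, hx, y, hy, hnear x hx, hnear y hy, hM⟩
    intro g h hg hh
    refine ⟨key g h hg.1 hh.1, ?_⟩
    rw [mul_inv_rev]
    exact key _ _ hh.2 hg.2

theorem IsolatedFamily.mem_peripheral (hF : IsolatedFamily F B φ) {E : Set X} (hE : E ∈ F)
    {g : Γ} : g ∈ hF.peripheral hE ↔
      (∀ x ∈ E, g • x ∈ nearSet B E) ∧ ∀ x ∈ E, g⁻¹ • x ∈ nearSet B E := Iff.rfl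

/-- Peripheral subgroups are malnormal. -/
theorem IsolatedFamily.mem_peripheral_of_conj [ProperSpace X] (hF : IsolatedFamily F B φ)
    (h : IsProperCocompactAction Γ X) (tf : ∀ g : Γ, g ≠ 1 → ¬ IsOfFinOrder g) {E : Set X}
    (hE : E ∈ F) {a g : Γ} (ha : a ∈ hF.peripheral hE) (ha1 : a ≠ 1)
    (hga : g * a * g⁻¹ ∈ hF.peripheral hE) : g ∈ hF.peripheral hE := by
  -- The points a^n x are unbounded and near E, and g a^n x = b^n g x stays near b^n x, hence near
  -- E. So g maps an unbounded part of E near E.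
  have key : ∀ a b g : Γ, a ∈ hF.peripheral hE → b ∈ hF.peripheral hE → a ≠ 1 → g * a = b * g →
      ∀ x ∈ E, g • x ∈ nearSet B E := by
    intro a b g ha hb ha1 hgab
    obtain ⟨x, hx⟩ := (hF.isFlat E hE).nonempty
    have hpow : ∀ n : ℕ, g * a ^ n = b ^ n * g := fun n =>
      (show SemiconjBy g a b from hgab).pow_right n
    have hy : ∀ n : ℕ, ∃ y ∈ E, dist (a ^ n • x) y ≤ B := fun n =>
      ((hF.mem_peripheral hE).1 (Subgroup.pow_mem _ ha n)).1 x hx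
    choose y hyE hyd using hy
    have hnear : ∀ n, g • y n ∈ nearSet (B + (dist (g • x) x + B)) E := by
      intro n
      have h1 : b ^ n • x ∈ nearSet B E :=
        ((hF.mem_peripheral hE).1 (Subgroup.pow_mem _ hb n)).1 x hx
      have h2 : g • a ^ n • x ∈ nearSet (dist (g • x) x + B) E := by
        refine mem_nearSet_of_dist_le h1 ?_
        rw [← mul_smul, hpow, mul_smul, dist_smul]
      refine mem_nearSet_of_dist_le h2 ?_
      rw [dist_smul, dist_comm]
      exact hyd n
    refine hF.smul_mem_nearSet hE (k := B + (dist (g • x) x + B)) fun M => ?_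
    obtain ⟨n, hn⟩ := h.exists_pow_far tf ha1 x (y 0) (M + B)
    refine ⟨y n, hyE n, y 0, hyE 0, hnear n, hnear 0, ?_⟩
    have h1 := dist_triangle (a ^ n • x) (y n) (y 0)
    have h2 := hyd n
    linarith
  refine ⟨key a _ g ha hga ha1 (by simp), key (g * a * g⁻¹) a g⁻¹ hga ha ?_ (by group)⟩
  intro he
  exact ha1 (by simpa using he)

/-- An isometric embedding between Euclidean spaces with coarsely dense image is onto. -/
theorem Isometry.surjective_of_coarselyDense {V W : Type*} [NormedAddCommGroup V]
    [NormedSpace ℝ V] [FiniteDimensional ℝ V] [NormedAddCommGroup W] [InnerProductSpace ℝ W]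
    {j : V → W} (hj : Isometry j) {C : ℝ} (hC : ∀ w, ∃ v, dist w (j v) ≤ C) :
    Function.Surjective j := by
  set A := hj.affineIsometryOfStrictConvexSpace with hA
  have hAj : ∀ v, A v = j v := fun v => by rw [hA, Isometry.coe_affineIsometryOfStrictConvexSpace]
  let S : Submodule ℝ W := LinearMap.range A.linear
  have hjS : ∀ v, j v - j 0 ∈ S := fun v => by
    refine ⟨v - 0, ?_⟩
    rw [← hAj, ← hAj]
    exact A.toAffineMap.linearMap_vsub v 0
  have htop : S = ⊤ := by
    by_contra hne
    have : Sᗮ ≠ ⊥ := fun hb => hne ((Submodule.orthogonal_eq_bot_iff).1 hb)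
    -- Moving along a vector orthogonal to the image would lead arbitrarily far from it.
    obtain ⟨u, hu, hu0⟩ := Submodule.exists_mem_ne_zero_of_ne_bot this
    have hpos : 0 < ‖u‖ := norm_pos_iff.2 hu0
    obtain ⟨n, hn⟩ := exists_nat_gt (C / ‖u‖)
    rw [div_lt_iff₀ hpos] at hn
    obtain ⟨v, hv⟩ := hC (j 0 + (n : ℝ) • u)
    have horth : inner ℝ ((n : ℝ) • u) (j v - j 0) = 0 :=
      Submodule.inner_left_of_mem_orthogonal (hjS v) (Sᗮ.smul_mem _ hu)
    have e : j 0 + (n : ℝ) • u - j v = (n : ℝ) • u - (j v - j 0) := by abel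
    have h1 : ‖(n : ℝ) • u‖ ≤ ‖(n : ℝ) • u - (j v - j 0)‖ := by
      refine le_of_sq_le_sq ?_ (norm_nonneg _)
      rw [norm_sub_sq_real, horth]
      linarith [sq_nonneg ‖j v - j 0‖]
    rw [dist_eq_norm, e] at hv
    rw [norm_smul, Real.norm_of_nonneg (Nat.cast_nonneg n)] at h1
    linarith
  intro w
  obtain ⟨v, hv⟩ : w - j 0 ∈ S := htop ▸ Submodule.mem_top
  refine ⟨v, ?_⟩
  have h1 := A.toAffineMap.linearMap_vsub v 0
  rw [vsub_eq_sub, sub_zero, vsub_eq_sub] at h1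
  have h2 : j v - j 0 = w - j 0 := by
    rw [← hv, ← hAj, ← hAj]; exact h1.symm
  exact sub_left_inj.1 h2

/-- A flat parallel to a member of the family is maximal. -/
theorem IsolatedFamily.isMaximalFlat_of_parallel (hF : IsolatedFamily F B φ) {k : ℕ} (hk : 2 ≤ k)
    {f₀ f : EuclideanSpace ℝ (Fin k) → X} (hf₀ : Isometry f₀) (hE : Set.range f₀ ∈ F)
    (hf : Isometry f) (hp : Parallel f₀ f) : IsMaximalFlat (Set.range f) := by
  refine ⟨⟨k, hk, f, hf, rfl⟩, ?_⟩
  intro E hEflat hle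
  obtain ⟨E', hE', hsub⟩ := hF.near E hEflat
  set d := dist (f₀ 0) (f 0) with hd
  -- E' is near the flat f, hence near f₀, so isolation identifies the two. Then E lies near f, and
  -- f is coarsely dense in E.
  have heq : Set.range f₀ = E' := by
    refine hF.eq_of_unbounded hE hE' (k := d + B) fun M => ?_
    have h1 : ∀ v, f₀ v ∈ nearSet (d + B) (Set.range f₀) := fun v =>
      ⟨f₀ v, ⟨v, rfl⟩, by rw [dist_self]; exact add_nonneg dist_nonneg hF.nonneg⟩
    have h2 : ∀ v, f₀ v ∈ nearSet (d + B) E' := fun v =>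
      mem_nearSet_of_dist_le (hsub (hle ⟨v, rfl⟩)) (hp.dist_eq v).le
    obtain ⟨v, hv⟩ := EuclideanSpace.exists_norm_eq (k := k) (by omega) (abs_nonneg M)
    refine ⟨f₀ v, f₀ 0, h1 v, h2 v, h1 0, h2 0, ?_⟩
    rw [hf₀.dist_eq, dist_zero_right, hv]
    exact le_abs_self M
  obtain ⟨m, -, f', hf', rfl⟩ := hEflat
  choose j hj using fun v => hle (⟨v, rfl⟩ : f v ∈ Set.range f)
  have hjiso : Isometry j := Isometry.of_dist_eq fun v w => by
    rw [← hf'.dist_eq, hj, hj, hf.dist_eq]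
  have hsurj := hjiso.surjective_of_coarselyDense (C := B + d) (fun w => by
    obtain ⟨y, hy, hyd⟩ := hsub ⟨w, rfl⟩
    rw [← heq] at hy
    obtain ⟨v, rfl⟩ := hy
    refine ⟨v, ?_⟩
    rw [← hf'.dist_eq, hj]
    exact (dist_triangle _ _ _).trans (add_le_add hyd (hp.dist_eq v).le))
  rintro _ ⟨w, rfl⟩
  obtain ⟨v, rfl⟩ := hsurj w
  exact ⟨v, (hj v).symm⟩

theorem IsFreeAbelian.mul_comm {H : Type*} [Group H] (h : IsFreeAbelian H) (a b : H) :
    a * b = b * a := by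
  obtain ⟨ι, ⟨e⟩⟩ := h
  exact e.injective (by rw [map_mul, map_mul, _root_.mul_comm])

/-- Peripheral subgroups of a toral action are abelian. -/
theorem IsolatedFamily.peripheral_comm [ProperSpace X] (hX : IsCAT0 X)
    (hF : IsolatedFamily F B φ) (htoral : IsToralAction Γ X) {E : Set X} (hE : E ∈ F) {a b : Γ}
    (ha : a ∈ hF.peripheral hE) (hb : b ∈ hF.peripheral hE) : a * b = b * a := by
  obtain ⟨k, hk, f₀, hf₀, rfl⟩ := hF.isFlat E hE
  obtain ⟨f, hf, hp, hinv⟩ := hX.exists_invariant_flat (hF.peripheral (Γ := Γ) hE) hf₀ (C := B)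
    (fun h hh v => by
      obtain ⟨_, ⟨w, rfl⟩, hw⟩ := hh.1 (f₀ v) ⟨v, rfl⟩
      exact ⟨w, hw⟩)
  have hmax := hF.isMaximalFlat_of_parallel hk hf₀ hE hf hp
  have hstab : ∀ h : Γ, h ∈ hF.peripheral hE → h ∈ MulAction.stabilizer Γ (Set.range f) := by
    intro h hh
    rw [MulAction.mem_stabilizer_iff]
    apply Set.Subset.antisymm
    · rintro _ ⟨_, ⟨v, rfl⟩, rfl⟩
      exact hinv h hh v
    · rintro _ ⟨v, rfl⟩
      rw [Set.mem_smul_set_iff_inv_smul_mem]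
      exact hinv h⁻¹ (Subgroup.inv_mem _ hh) v
  have := (htoral _ hmax).mul_comm ⟨a, hstab a ha⟩ ⟨b, hstab b hb⟩
  exact congrArg Subtype.val this

end Peripheral

/-! ### Coarse stabilisers of lines -/

section Line

variable {X : Type v} [MetricSpace X] {Γ : Type u} [Group Γ] [MulAction Γ X]
  [IsIsometricSMul Γ X]

/-- The group of elements that move a line `f` to a line at finite distance. -/
def lineStabilizer (Γ : Type u) [Group Γ] [MulAction Γ X] [IsIsometricSMul Γ X] (f : ℝ → X) :
    Subgroup Γ where
  carrier := {g | (∃ C, ∀ s, g • f s ∈ nearSet C (Set.range f)) ∧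
    ∃ C, ∀ s, g⁻¹ • f s ∈ nearSet C (Set.range f)}
  one_mem' := by
    have : ∃ C, ∀ s, f s ∈ nearSet C (Set.range f) :=
      ⟨0, fun s => ⟨f s, ⟨s, rfl⟩, by rw [dist_self]⟩⟩
    simpa using this
  inv_mem' := fun {g} hg => ⟨hg.2, by simpa using hg.1⟩
  mul_mem' := by
    have key : ∀ g h : Γ, (∃ C, ∀ s, g • f s ∈ nearSet C (Set.range f)) →
        (∃ C, ∀ s, h • f s ∈ nearSet C (Set.range f)) →
        ∃ C, ∀ s, (g * h) • f s ∈ nearSet C (Set.range f) := by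
      rintro g h ⟨C, hC⟩ ⟨C', hC'⟩
      refine ⟨C' + C, fun s => ?_⟩
      obtain ⟨_, ⟨t, rfl⟩, hd⟩ := hC' s
      refine mem_nearSet_of_dist_le (hC t) ?_
      rwa [mul_smul, dist_smul]
    intro g h hg hh
    refine ⟨key g h hg.1 hh.1, ?_⟩
    rw [mul_inv_rev]
    exact key _ _ hh.2 hg.2

theorem mem_lineStabilizer {f : ℝ → X} {g : Γ} : g ∈ lineStabilizer Γ f ↔
    (∃ C, ∀ s, g • f s ∈ nearSet C (Set.range f)) ∧
    ∃ C, ∀ s, g⁻¹ • f s ∈ nearSet C (Set.range f) := Iff.rfl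

/-- An element conjugating one translation along a line to another maps the line to a line at
finite distance. -/
theorem smul_line_near_of_semiconj {f : ℝ → X} (hf : Isometry f) {a b g : Γ} {α β : ℝ}
    (ha : ∀ s, a • f s = f (s + α)) (hb : ∀ s, b • f s = f (s + β)) (hβ : β ≠ 0)
    (hg : SemiconjBy g b a) : ∃ C, ∀ s, g • f s ∈ nearSet C (Set.range f) := by
  have hzpow : ∀ {c : Γ} {γ : ℝ}, (∀ s, c • f s = f (s + γ)) → ∀ (n : ℤ) s,
      c ^ n • f s = f (s + n * γ) := by
    intro c γ hc n
    induction n using Int.induction_on with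
    | zero => intro s; simp
    | succ i ih =>
      intro s
      rw [zpow_add_one, mul_smul, hc, ih]
      congr 1; push_cast; ring
    | pred i ih =>
      intro s
      have : c⁻¹ • f s = f (s - γ) := by
        rw [inv_smul_eq_iff, hc, sub_add_cancel]
      rw [zpow_sub_one, mul_smul, this, ih]
      congr 1; push_cast; ring
  -- Reduce s modulo β to s₀ and use g b^n = a^n g; the term 2|β| pays for replacing s₀ by 0 twice.
  refine ⟨dist (g • f 0) (f 0) + 2 * |β|, fun s => ?_⟩
  set n := ⌊s / β⌋ with hn
  set s₀ := s - n * β with hs₀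
  have hbound : |s₀| ≤ |β| := by
    have e : s₀ = Int.fract (s / β) * β := by
      rw [hs₀, hn, ← Int.self_sub_floor, sub_mul, div_mul_cancel₀ _ hβ]
    rw [e, abs_mul, abs_of_nonneg (Int.fract_nonneg _)]
    exact mul_le_of_le_one_left (abs_nonneg _) (Int.fract_lt_one _).le
  have e1 : f s = b ^ n • f s₀ := by rw [hzpow hb, hs₀, sub_add_cancel]
  refine ⟨f (s₀ + n * α), ⟨_, rfl⟩, ?_⟩
  rw [e1, ← hzpow ha, ← mul_smul, (hg.zpow_right n).eq, mul_smul, dist_smul]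
  have h1 := dist_triangle4 (g • f s₀) (g • f 0) (f 0) (f s₀)
  rw [dist_smul, hf.dist_eq, hf.dist_eq, dist_zero_left, dist_zero_right, Real.norm_eq_abs] at h1
  linarith

/-- A torsion-free group acting properly and preserving a line acts on it by translations, and
is abelian. -/
theorem IsProperCocompactAction.translations_of_invariant_line
    (h : IsProperCocompactAction Γ X) (tf : ∀ g : Γ, g ≠ 1 → ¬ IsOfFinOrder g)
    (H : Subgroup Γ) {f : ℝ → X} (hf : Isometry f) (hH : ∀ g ∈ H, ∀ s, g • f s ∈ Set.range f) :
    (∀ g ∈ H, ∃ α, ∀ s, g • f s = f (s + α)) ∧ ∀ g ∈ H, ∀ g' ∈ H, g * g' = g' * g := by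
  obtain ⟨ρ, hρ⟩ := exists_affineIsometricAction_of_invariant H hf hH
  have hlin : ∀ (g : H) (s : ℝ), ρ.lin g s = s := by
    intro g s
    have hs : ρ.lin g s = s * ρ.lin g 1 := by
      have := (ρ.lin g).map_smul s 1
      simpa using this
    have h1 : |ρ.lin g 1| = 1 := by
      have := ρ.norm_lin g 1
      simpa using this
    rcases eq_or_eq_neg_of_abs_eq h1 with h2 | h2
    · rw [hs, h2, mul_one]
    -- A linear part -1 is a reflection with this fixed point, which freeness allows only for g = 1.
    · have hfix : (g : Γ) • f (ρ.trans g / 2) = f (ρ.trans g / 2) := by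
        rw [← hρ]
        congr 1
        have := (ρ.lin g).map_smul (ρ.trans g / 2) 1
        simp only [smul_eq_mul, mul_one] at this
        rw [this, h2]; ring
      have hg1 : g = 1 := Subtype.ext (h.eq_one_of_smul_eq tf hfix)
      rw [hg1]; simp
  have htr : ∀ (g : H) s, (g : Γ) • f s = f (s + ρ.trans g) := fun g s => by
    rw [← hρ, hlin]
  refine ⟨fun g hg => ⟨_, htr ⟨g, hg⟩⟩, fun g hg g' hg' => ?_⟩
  have h1 : (g * g') • f 0 = (g' * g) • f 0 := by
    rw [mul_smul, mul_smul, htr ⟨g, hg⟩, htr ⟨g', hg'⟩, htr ⟨g, hg⟩, htr ⟨g', hg'⟩]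
    congr 1; ring
  have h2 : ((g' * g)⁻¹ * (g * g')) • f 0 = f 0 := by
    rw [mul_smul, h1, inv_smul_smul]
  have h3 := h.eq_one_of_smul_eq tf h2
  exact (inv_mul_eq_one.1 h3).symm

end Line

/-! ### Toral actions and CSA -/

section Main

variable {X : Type v} [MetricSpace X] {F : Set (Set X)} {B : ℝ} {φ : ℝ → ℝ}
  {Γ : Type u} [Group Γ] [MulAction Γ X] [IsIsometricSMul Γ X]

/-- The coarse stabiliser of the axis of a non-peripheral element preserves a line parallel to
the axis. -/
theorem IsolatedFamily.exists_invariant_line [ProperSpace X] (hX : IsCAT0 X)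
    (hF : IsolatedFamily F B φ) (h : IsProperCocompactAction Γ X) {a : Γ}
    (ha : ∀ E (hE : E ∈ F), a ∉ hF.peripheral hE) {f : ℝ → X} (hf : Isometry f) {τ : ℝ}
    (hτ : ∀ s, a • f s = f (s + τ)) :
    ∃ f' : ℝ → X, Isometry f' ∧ Parallel f f' ∧
      ∀ g ∈ lineStabilizer Γ f, ∀ s, g • f' s ∈ Set.range f' := by
  obtain ⟨R, hR⟩ := h.exists_flat_near_wide_strip hX hF
  have hnarrow : ∀ f' : ℝ → X, Isometry f' → Parallel f f' → dist (f 0) (f' 0) ≤ R := by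
    intro f' hf' hp
    by_contra! hlt
    obtain ⟨E, hE, C, hC⟩ := hR f f' hf hf' hp hlt.le
    refine ha E hE ?_
    have hinv : ∀ s, a⁻¹ • f s = f (s + -τ) := fun s => by
      rw [inv_smul_eq_iff, hτ]; congr 1; ring
    have key : ∀ (g : Γ) (σ : ℝ), (∀ s, g • f s = f (s + σ)) → ∀ x ∈ E, g • x ∈ nearSet B E := by
      intro g σ hg
      choose y hyE hyd using hC
      have hnear : ∀ s, g • y s ∈ nearSet (C + C) E := by
        intro s
        refine mem_nearSet_of_dist_le (y := g • f s) ?_ ?_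
        · rw [hg]; exact ⟨_, hyE _, hyd _⟩
        · rw [dist_smul, dist_comm]; exact hyd s
      refine hF.smul_mem_nearSet hE (k := C + C) fun M => ?_
      refine ⟨y (|M| + C + C), hyE _, y 0, hyE 0, hnear _, hnear 0, ?_⟩
      have hC0 : 0 ≤ C := dist_nonneg.trans (hyd 0)
      have h1 := dist_triangle4 (f (|M| + C + C)) (y (|M| + C + C)) (y 0) (f 0)
      rw [hf.dist_eq, dist_zero_right, Real.norm_of_nonneg (by positivity), dist_comm (y 0)] at h1
      linarith [hyd 0, hyd (|M| + C + C), le_abs_self M]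
    exact ⟨key a τ hτ, key a⁻¹ (-τ) hinv⟩
  -- The constants in `lineStabilizer` depend on g; `hnarrow` replaces them by the uniform R that
  -- the circumcentre needs.
  refine hX.exists_invariant_flat (lineStabilizer Γ f) hf (C := R) fun g hg s => ?_
  obtain ⟨⟨C, hC⟩, C', hC'⟩ := mem_lineStabilizer.1 hg
  have hgf : Isometry fun s => g • f s := (isometry_smul X g).comp hf
  obtain ⟨A, hA, hAs, hAp⟩ := hX.exists_parallel_reparam hf hgf (C := C') (C' := C)
    (fun s => by
      obtain ⟨_, ⟨t, rfl⟩, hd⟩ := hC' s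
      refine ⟨t, ?_⟩
      rwa [← dist_smul g, smul_inv_smul] at hd)
    (fun s => by
      obtain ⟨_, ⟨t, rfl⟩, hd⟩ := hC s
      exact ⟨t, hd⟩)
  obtain ⟨t, rfl⟩ := hAs s
  refine ⟨t, ?_⟩
  rw [dist_comm]
  exact (hAp.dist_eq t).le.trans (hnarrow _ (hgf.comp hA) hAp)

theorem mem_lineStabilizer_of_parallel {f f' : ℝ → X} (hp : Parallel f f') {g : Γ}
    (hg : ∃ C, ∀ s, g • f' s ∈ nearSet C (Set.range f'))
    (hg' : ∃ C, ∀ s, g⁻¹ • f' s ∈ nearSet C (Set.range f')) : g ∈ lineStabilizer Γ f := by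
  have key : ∀ g : Γ, (∃ C, ∀ s, g • f' s ∈ nearSet C (Set.range f')) →
      ∃ C, ∀ s, g • f s ∈ nearSet C (Set.range f) := by
    rintro g ⟨C, hC⟩
    refine ⟨dist (f 0) (f' 0) + (C + dist (f 0) (f' 0)), fun s => ?_⟩
    refine mem_nearSet_of_dist_le (y := g • f' s) ?_ (by rw [dist_smul, hp.dist_eq])
    obtain ⟨_, ⟨t, rfl⟩, hd⟩ := hC s
    refine mem_nearSet_of_dist_le (y := f' t) ⟨f t, ⟨t, rfl⟩, ?_⟩ hd
    rw [dist_comm, hp.dist_eq]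
  exact ⟨key g hg, key g⁻¹ hg'⟩

/-- A torsion-free group with a toral action on a CAT(0) space with isolated flats is CSA. -/
theorem isCSA_of_isToralAction (tf : ∀ g : Γ, g ≠ 1 → ¬ IsOfFinOrder g) (hX : IsCAT0 X)
    (hiso : HasIsolatedFlats X) (h : IsProperCocompactAction Γ X) (htoral : IsToralAction Γ X) :
    IsCSA Γ := by
  have := h.properSpace hX
  obtain ⟨F, B, φ, hF⟩ := hiso.exists_family
  intro A hA g hgA
  have hAcomm : ∀ x ∈ A, ∀ y ∈ A, x * y = y * x := by
    have := hA.prop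
    exact fun x hx y hy => setLike_mul_comm hx hy
  have hmax : ∀ N : Subgroup Γ, A ≤ N → (∀ x ∈ N, ∀ y ∈ N, x * y = y * x) → N ≤ A :=
    fun N hle hN => hA.le_of_ge (IsMulCommutative.of_setLike_mul_comm fun x hx y hy =>
      hN x hx y hy) hle
  rw [eq_bot_iff]
  rintro a ⟨⟨b, hb, hgb⟩, ha⟩
  rw [Subgroup.mem_bot]
  by_contra ha1
  have hgb' : g * b * g⁻¹ = a := hgb
  have hb1 : b ≠ 1 := by
    rintro rfl
    exact ha1 (by simpa using hgb'.symm)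
  apply hgA
  by_cases hper : ∃ E, ∃ hE : E ∈ F, a ∈ hF.peripheral hE
  · obtain ⟨E, hE, haP⟩ := hper
    have hAP : A ≤ hF.peripheral hE := fun x hx =>
      hF.mem_peripheral_of_conj h tf hE haP ha1 (by
        rw [hAcomm x hx a ha, mul_inv_cancel_right]; exact haP)
    refine hmax _ hAP (fun x hx y hy => hF.peripheral_comm hX htoral hE hx hy) ?_
    exact hF.mem_peripheral_of_conj h tf hE (hAP hb) hb1 (by rw [hgb']; exact haP)
  · push Not at hper
    obtain ⟨x, hx⟩ := h.exists_min_displacement hX.nonempty a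
    have hpos : 0 < dist x (a • x) := by
      refine dist_pos.2 fun he => ha1 (h.eq_one_of_smul_eq tf he.symm)
    obtain ⟨f, hf, hτ⟩ := hX.exists_axis hx hpos
    obtain ⟨f', hf', hp, hinv⟩ := hF.exists_invariant_line hX h hper hf hτ
    obtain ⟨htrans, hcomm⟩ := h.translations_of_invariant_line tf (lineStabilizer Γ f) hf' hinv
    have hAN : A ≤ lineStabilizer Γ f := by
      intro y hy
      have hsemi : ∀ z ∈ A, SemiconjBy z a a := fun z hz => hAcomm z hz a ha
      exact ⟨smul_line_near_of_semiconj hf hτ hτ hpos.ne' (hsemi y hy),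
        smul_line_near_of_semiconj hf hτ hτ hpos.ne' (hsemi y⁻¹ (A.inv_mem hy))⟩
    refine hmax _ hAN hcomm ?_
    -- The element b is only known to translate the invariant line f', so g is shown to preserve f'
    -- coarsely, and parallelism transfers this to f.
    obtain ⟨α, hα⟩ := htrans a (hAN ha)
    obtain ⟨β, hβ⟩ := htrans b (hAN hb)
    have hne : ∀ {c : Γ} {γ : ℝ}, c ≠ 1 → (∀ s, c • f' s = f' (s + γ)) → γ ≠ 0 := by
      rintro c γ hc hγ rfl
      exact hc (h.eq_one_of_smul_eq tf (x := f' 0) (by rw [hγ, add_zero]))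
    have hsemi : SemiconjBy g b a := by
      change g * b = a * g
      rw [← hgb']; group
    exact mem_lineStabilizer_of_parallel hp
      (smul_line_near_of_semiconj hf' hα hβ (hne hb1 hβ) hsemi)
      (smul_line_near_of_semiconj hf' hβ hα (hne ha1 hα) hsemi.inv_symm_left)

end Main

theorem lemma2p10 (Γ : Type u) [Group Γ] (torsionFree : ∀ g : Γ, g ≠ 1 → ¬ IsOfFinOrder g) :
    (IsToralCAT0GroupWithIsolatedFlats.{u, v} Γ →
      ∀ (Y : Type w) [MetricSpace Y] [MulAction Γ Y],
        IsCAT0 Y → HasIsolatedFlats Y → IsProperCocompactAction Γ Y → IsToralAction Γ Y) ∧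
    (IsCAT0GroupWithIsolatedFlats.{u, v} Γ →
      (IsToralCAT0GroupWithIsolatedFlats.{u, v} Γ ↔ IsCSA Γ)) := by
  have toCSA : IsToralCAT0GroupWithIsolatedFlats.{u, v} Γ → IsCSA Γ := by
    rintro ⟨X, _, _, hX, hiso, hact, htoral⟩
    have := hact.isIsometricSMul
    exact isCSA_of_isToralAction torsionFree hX hiso hact htoral
  refine ⟨?_, ?_⟩
  · intro htor Y _ _ _ _ hact E hE
    exact isFreeAbelian_stabilizer_of_isCSA hact torsionFree (toCSA htor) hE.prop
  · rintro ⟨X, _, _, hX, hiso, hact⟩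
    exact ⟨toCSA, fun hcsa => ⟨X, _, _, hX, hiso, hact, fun E hE =>
      isFreeAbelian_stabilizer_of_isCSA hact torsionFree hcsa hE.prop⟩⟩
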